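/- Let $\bar q\in\mathbb R$ satisfy $\bar q>-\pi^2/4$, and let $$\sigma^{(\bar q)}(\zeta)=\tfrac14\left(e^{\sqrt{\bar q}\,\zeta}+e^{-\sqrt{\bar q}\,\zeta}\right)^2,\qquad \zeta\in[0,1]$$ (for $\bar q<0$ this is $\cos^2(\sqrt{-\bar q}\,\zeta)$), and $\sigma^{(o)}\equiv 1$. For a conductivity $\sigma>0$ on $[0,1]$, let $-\delta_1^2>-\delta_2^2>\dots$ (with $0<\delta_1<\delta_2<\cdots$) be the eigenvalues of the problem $(\sigma y')'=-\delta^2\sigma y$ on $(0,1)$, $y'(0)=0$, $y(1)=0$, let $y_j$ be the eigenfunctions with $\int_0^1y_j^2\,\sigma\,d\zeta=1$, and let $\xi_j=y_j(0)^2$. For $\ell\ge1$ consider positive numbers $\alpha_1,\dots,\alpha_\ell,\hat\alpha_1,\dots,\hat\alpha_\ell$ and the $\ell\times\ell$ tridiagonal matrix $A$ of the difference operator $$(AV)_i=\frac1{\hat\alpha_i}\left(\frac{V_{i+1}-V_i}{\alpha_i}-\frac{V_i-V_{i-1}}{\alpha_{i-1}}\right),\quad 1\le i\le\ell,$$ where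 $V_{\ell+1}=0$ and where the second difference quotient is omitted for $i=1$. They solve the discrete inverse spectral problem with data $(\delta_j,\xi_j)_{j=1}^\ell$ if $A$ has the eigenvalues $-\delta_j^2$, $j=1,\dots,\ell$, with eigenvectors $Y_j=(Y_{1,j},\dots,Y_{\ell,j})^T$ satisfying $\sum_{p=1}^\ell\hat\alpha_pY_{p,j}^2=1$ and $Y_{1,j}^2=\xi_j$. The spectral data of $\sigma^{(o)}$ and of $\sigma^{(\bar q)}$ are well defined, and for every $\ell$ the discrete inverse spectral problem has exactly one solution $\{\alpha^{(o)}_j,\hat\alpha^{(o)}_j\}$ for the data of $\sigma^{(o)}$ and exactly one solution $\{\alpha^{(\bar q)}_j,\hat\alpha^{(\bar q)}_j\}$ for the data of $\sigma^{(\bar q)}$. Define the optimal grid $$\zeta_{j+1}=\sum_{p=1}^j\alpha^{(o)}_p,\qquad \hat\zeta_{j+1}=\sum_{p=1}^j\hat\alpha^{(o)}_p,\qquad 0\le j\le\ell,$$ the reconstructed point values $$\sigma_j=\frac{\hat\alpha_j^{(\bar q)}}{\hat\alpha_j^{(o)}},\qquad \hat\sigma_{j+1}=\frac{\alpha_j^{(o)}}{\alpha_j^{(\bar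 q)}},\qquad 1\le j\le\ell,$$ and the piecewise constant reconstruction $\sigma^{(\bar q),\ell}$ on $[0,1]$, equal to $\sigma_j$ on $[\zeta_j,\hat\zeta_{j+1})$ and to $\hat\sigma_{j+1}$ on $[\hat\zeta_{j+1},\zeta_{j+1})$ for $1\le j\le\ell$, and to $\hat\sigma_{\ell+1}$ on $[\zeta_{\ell+1},1]$. Then, as $\ell\to\infty$, $$\max_{1\le j\le\ell}\left|\sigma_j-\sigma^{(\bar q)}(\zeta_j)\right|\to0,\qquad \max_{1\le j\le\ell}\left|\hat\sigma_{j+1}-\sigma^{(\bar q)}(\hat\zeta_{j+1})\right|\to0,$$ and $\sigma^{(\bar q),\ell}\to\sigma^{(\bar q)}$ in $L^\infty[0,1]$. -/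

import Mathlib

open MeasureTheory Filter Topology Set

noncomputable section

/-- The conductivity `σ(ζ) = (1/4) (e^{√q ζ} + e^{-√q ζ})²` with constant Schrödinger potential
`q`, i.e. the square of the solution of `s'' = q s`, `s 0 = 1`, `s' 0 = 0`. For `q < 0` the square
root is imaginary and the formula reads `cos² (√(-q) ζ)`. -/
def sigmaConst (q ζ : ℝ) : ℝ :=
  if 0 ≤ q then
    (1 / 4) * (Real.exp (Real.sqrt q * ζ) + Real.exp (-(Real.sqrt q * ζ))) ^ 2
  else Real.cos (Real.sqrt (-q) * ζ) ^ 2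

/-- The reference conductivity. -/
def sigmaRef (_ζ : ℝ) : ℝ := 1

/-- `y` is an eigenfunction on `[0,1]`, for the eigenvalue `μ`, of the operator
`d/dẑ (d/dz)`, where `dz = dζ / σ` and `dẑ = σ dζ`, with a homogeneous Neumann condition at `ζ = 0`
and a homogeneous Dirichlet condition at `ζ = 1`. Here `p` is the flux `dy/dz = σ dy/dζ`, and
`dp/dẑ = μ y` means `dp/dζ = μ σ y`. -/
def IsEigenfunction (σ : ℝ → ℝ) (μ : ℝ) (y : ℝ → ℝ) : Prop :=
  (∃ p : ℝ → ℝ,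
    (∀ ζ ∈ Icc (0 : ℝ) 1, HasDerivWithinAt y (p ζ / σ ζ) (Icc 0 1) ζ) ∧
    (∀ ζ ∈ Icc (0 : ℝ) 1, HasDerivWithinAt p (μ * σ ζ * y ζ) (Icc 0 1) ζ) ∧
    p 0 = 0) ∧
  y 1 = 0 ∧ ∃ ζ ∈ Icc (0 : ℝ) 1, y ζ ≠ 0

/-- Two sequences of numbers `δ₁, δ₂, …` and `ξ₁, ξ₂, …`; the entry with index `j : ℕ` is the one
numbered `j + 1` in the usual notation. -/
@[ext] structure SpectralData where
  /-- the numbers `δ` -/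
  δ : ℕ → ℝ
  /-- the weights `ξ` -/
  ξ : ℕ → ℝ

/-- `D` is the spectral data of the conductivity `σ`: the eigenvalues of `d/dẑ (d/dz)` are exactly
the numbers `-δ_j²`, with `0 < δ₁ < δ₂ < …`, and `ξ_j = y_j(0)²` for an eigenfunction `y_j` with
`∫₀¹ y_j² σ dζ = 1`. -/
structure IsSpectralData (σ : ℝ → ℝ) (D : SpectralData) : Prop where
  pos : ∀ j, 0 < D.δ j
  strictMono : StrictMono D.δ
  eigenvalue_iff : ∀ μ : ℝ, (∃ y, IsEigenfunction σ μ y) ↔ ∃ j, μ = -(D.δ j) ^ 2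
  weight : ∀ j, ∃ y, IsEigenfunction σ (-(D.δ j) ^ 2) y ∧
    (∫ ζ in (0 : ℝ)..1, y ζ ^ 2 * σ ζ) = 1 ∧ D.ξ j = y 0 ^ 2

/-- The coefficients `α₁, …, α_ℓ` (primary) and `α̂₁, …, α̂_ℓ` (dual) of a layered resistor network;
the index `j : Fin ℓ` stands for the number `j + 1`. -/
@[ext] structure Coeffs (ℓ : ℕ) where
  /-- the coefficients `α` -/
  prim : Fin ℓ → ℝ
  /-- the coefficients `α̂` -/
  dual : Fin ℓ → ℝ

/-- The tridiagonal matrix of the difference operator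
`V ↦ (1/α̂_i) ((V_{i+1} - V_i)/α_i - (V_i - V_{i-1})/α_{i-1})`, `i = 1, …, ℓ`, where the second
difference quotient is absent for `i = 1`, and `V_{ℓ+1} = 0`. -/
def jacobiMatrix {ℓ : ℕ} (c : Coeffs ℓ) : Matrix (Fin ℓ) (Fin ℓ) ℝ :=
  Matrix.of fun i j =>
    if j = i then
      -(1 / c.dual i) *
        (1 / c.prim i + ∑ k : Fin ℓ, if k.val + 1 = i.val then 1 / c.prim k else 0)
    else if j.val = i.val + 1 then 1 / (c.dual i * c.prim i)
    else if j.val + 1 = i.val then 1 / (c.dual i * c.prim j)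
    else 0

/-- `c` solves the discrete inverse spectral problem with data `(δ_j, ξ_j)`, `j = 1, …, ℓ`: the
coefficients are positive, and the `-δ_j²` are the eigenvalues of the tridiagonal matrix, with
eigenvectors `Y` that are normalized in the inner product with weights `α̂` and satisfy
`Y₁² = ξ_j`. -/
structure SolvesInverse (D : SpectralData) {ℓ : ℕ} (c : Coeffs ℓ) : Prop where
  prim_pos : ∀ j, 0 < c.prim j
  dual_pos : ∀ j, 0 < c.dual j
  spectrum : ∀ j : Fin ℓ, ∃ Y : Fin ℓ → ℝ,
    (jacobiMatrix c).mulVec Y = (-(D.δ j) ^ 2) • Y ∧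
    (∑ p, c.dual p * Y p ^ 2) = 1 ∧
    ∀ p : Fin ℓ, p.val = 0 → Y p ^ 2 = D.ξ j

/-- The primary node `α₁ + … + α_k`, i.e. the node numbered `k + 1`, for `k = 0, …, ℓ`. -/
def primNode {ℓ : ℕ} (c : Coeffs ℓ) (k : ℕ) : ℝ :=
  ∑ i : Fin ℓ, if i.val < k then c.prim i else 0

/-- The dual node `α̂₁ + … + α̂_k`, i.e. the node numbered `k + 1`, for `k = 0, …, ℓ`. -/
def dualNode {ℓ : ℕ} (c : Coeffs ℓ) (k : ℕ) : ℝ :=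
  ∑ i : Fin ℓ, if i.val < k then c.dual i else 0

/-- The reconstructed primary point values `σ_j = α̂_j / α̂_j^{(o)}`; `c₀` holds the coefficients
of the reference conductivity. -/
def primValue {ℓ : ℕ} (c₀ c : Coeffs ℓ) (j : Fin ℓ) : ℝ := c.dual j / c₀.dual j

/-- The reconstructed dual point values `σ̂_{j+1} = α_j^{(o)} / α_j`. -/
def dualValue {ℓ : ℕ} (c₀ c : Coeffs ℓ) (j : Fin ℓ) : ℝ := c₀.prim j / c.prim j

/-- The piecewise constant reconstruction on `[0,1]`: the value is `σ_j` between the `j`-th primary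
node and the next dual node, `σ̂_{j+1}` between the dual node `j+1` and the primary node `j+1`, and
`σ̂_{ℓ+1}` from the last primary node up to `1`. -/
def reconstruction {ℓ : ℕ} (c₀ c : Coeffs ℓ) (ζ : ℝ) : ℝ :=
  ∑ j : Fin ℓ,
    ((Ico (primNode c₀ j.val) (dualNode c₀ (j.val + 1))).indicator
        (fun _ => primValue c₀ c j) ζ +
      (Ico (dualNode c₀ (j.val + 1)) (primNode c₀ (j.val + 1))).indicator
        (fun _ => dualValue c₀ c j) ζ +
      if j.val + 1 = ℓ then
        (Icc (primNode c₀ ℓ) 1).indicator (fun _ => dualValue c₀ c j) ζ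
      else 0)

end

/-! Let `s = genCos q`, so that the conductivity is `s ^ 2` and `s'' = q s`. The Liouville transform
`w = s y` turns the eigenvalue problem into `w'' = (μ + q) w`, `w'(0) = 0`, `w(1) = 0`. Hence the
potential `q` only shifts the spectrum: the eigenvalues are `-(freq j ^ 2 + q)`, and all weights
equal `2`, as for the reference conductivity.

The discrete problem has the same structure. For `q = 0` it is solved by discrete Chebyshev (Gram)
polynomials on `2 * ℓ` equispaced points: as functions of the degree, evaluated at `j + 1/2`, they
are the eigenvectors, and their three-term recurrence yields the coefficients
(`solvesInverse_gramCoeffs`). For general `q`, let `S` be the grid solution `gridCos` for the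
spectral parameter `q`, the discrete counterpart of `s`. Dividing eigenvectors by `S` shifts the
spectrum by `-q` and gives the coefficients `α_j / (S_j S_{j+1})` and `α̂_j S_j ^ 2`
(`solvesInverse_liouvilleCoeffs`). By uniqueness (`SolvesInverse.unique`) these are the solutions,
so the reconstructed values are exactly `S_j ^ 2` and `S_j S_{j+1}`.

It remains to show that `S` approximates `s` uniformly. The interlaced steps increase (through
Wallis' product), so the two families of nodes interlace; the largest step tends to `0`; and the
length of the grid is a partial sum of a series with sum `1`. Consistency and a discrete Gronwall
argument (`gridCos_error`) then give convergence. -/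

noncomputable section

/-! ### The continuous problem: Liouville transform and explicit spectral data. -/

/-- The solution of `s'' = κ s`, `s 0 = 1`, `s' 0 = 0`. -/
def genCos (κ x : ℝ) : ℝ :=
  if 0 ≤ κ then Real.cosh (Real.sqrt κ * x) else Real.cos (Real.sqrt (-κ) * x)

/-- The derivative of `genCos κ`. -/
def genCosDeriv (κ x : ℝ) : ℝ :=
  if 0 ≤ κ then Real.sqrt κ * Real.sinh (Real.sqrt κ * x)
  else -(Real.sqrt (-κ) * Real.sin (Real.sqrt (-κ) * x))

/-- The solution of `s'' = κ s`, `s 0 = 0`, `s' 0 = 1`. -/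
def genSin (κ x : ℝ) : ℝ := if κ = 0 then x else genCosDeriv κ x / κ

lemma sigmaConst_eq_sq (q x : ℝ) : sigmaConst q x = genCos q x ^ 2 := by
  unfold sigmaConst genCos
  split_ifs
  · rw [Real.cosh_eq]; ring
  · rfl

lemma sigmaRef_eq : sigmaRef = sigmaConst 0 := by
  funext x
  simp [sigmaRef, sigmaConst_eq_sq, genCos]

lemma genCos_zero (κ : ℝ) : genCos κ 0 = 1 := by simp [genCos]

lemma genCosDeriv_zero (κ : ℝ) : genCosDeriv κ 0 = 0 := by simp [genCosDeriv]

lemma genSin_zero (κ : ℝ) : genSin κ 0 = 0 := by simp [genSin, genCosDeriv_zero]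

lemma hasDerivAt_genCos (κ x : ℝ) : HasDerivAt (genCos κ) (genCosDeriv κ x) x := by
  unfold genCos genCosDeriv
  split_ifs
  · refine HasDerivAt.congr_deriv
      ((Real.hasDerivAt_cosh (Real.sqrt κ * x)).comp x
      ((hasDerivAt_id x).const_mul (Real.sqrt κ))) ?_
    ring
  · refine HasDerivAt.congr_deriv
      ((Real.hasDerivAt_cos (Real.sqrt (-κ) * x)).comp x
      ((hasDerivAt_id x).const_mul (Real.sqrt (-κ)))) ?_
    ring

lemma hasDerivAt_genCosDeriv (κ x : ℝ) : HasDerivAt (genCosDeriv κ) (κ * genCos κ x) x := by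
  unfold genCos genCosDeriv
  split_ifs with h
  · refine HasDerivAt.congr_deriv
      (((Real.hasDerivAt_sinh (Real.sqrt κ * x)).comp x
      ((hasDerivAt_id x).const_mul (Real.sqrt κ))).const_mul (Real.sqrt κ)) ?_
    linear_combination (Real.cosh (Real.sqrt κ * x)) * Real.mul_self_sqrt h
  · refine HasDerivAt.congr_deriv
      ((((Real.hasDerivAt_sin (Real.sqrt (-κ) * x)).comp x
      ((hasDerivAt_id x).const_mul (Real.sqrt (-κ)))).const_mul (Real.sqrt (-κ))).neg) ?_
    have h' : 0 ≤ -κ := by linarith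
    linear_combination (-Real.cos (Real.sqrt (-κ) * x)) * Real.mul_self_sqrt h'

lemma mul_genSin (κ x : ℝ) : κ * genSin κ x = genCosDeriv κ x := by
  unfold genSin
  split_ifs with h
  · subst h; simp [genCosDeriv]
  · field_simp

lemma genCos_zero_left (x : ℝ) : genCos 0 x = 1 := by simp [genCos]

lemma hasDerivAt_genSin (κ x : ℝ) : HasDerivAt (genSin κ) (genCos κ x) x := by
  unfold genSin
  split_ifs with h
  · subst h; rw [genCos_zero_left]; exact hasDerivAt_id x
  · refine HasDerivAt.congr_deriv
      ((hasDerivAt_genCosDeriv κ x).div_const κ) ?_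
    field_simp

lemma genCos_sq_sub (κ x : ℝ) : genCos κ x ^ 2 - κ * genSin κ x ^ 2 = 1 := by
  by_cases h : κ = 0
  · subst h; simp [genCos]
  have h2 : κ * genSin κ x ^ 2 = genCosDeriv κ x ^ 2 / κ := by
    rw [← mul_genSin]; field_simp
  rw [h2]
  unfold genCos genCosDeriv
  split_ifs with h0
  · rw [mul_pow, Real.sq_sqrt h0, mul_div_right_comm, div_self h, one_mul]
    have := Real.cosh_sq (Real.sqrt κ * x)
    linarith
  · have h' : 0 ≤ -κ := by linarith
    rw [neg_sq, mul_pow, Real.sq_sqrt h']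
    have := Real.sin_sq_add_cos_sq (Real.sqrt (-κ) * x)
    field_simp
    linarith

lemma neg_pi_sq_div_four_neg : -(Real.pi ^ 2 / 4) < 0 := by
  have := Real.pi_pos
  have : 0 < Real.pi ^ 2 / 4 := by positivity
  linarith

/-- The bound on `q` says precisely that for `q < 0` the argument of the cosine stays below its
first zero `π / 2`. -/
lemma genCos_pos {q : ℝ} (hq : -(Real.pi ^ 2 / 4) < q) {x : ℝ} (hx : x ∈ Icc (0 : ℝ) 1) :
    0 < genCos q x := by
  unfold genCos
  split_ifs with h
  · exact Real.cosh_pos _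
  · have hs : Real.sqrt (-q) < Real.pi / 2 := by
      rw [Real.sqrt_lt' (by positivity)]
      nlinarith
    have h0 := Real.sqrt_nonneg (-q)
    apply Real.cos_pos_of_mem_Ioo
    constructor
    · have := mul_nonneg h0 hx.1
      linarith [Real.pi_pos]
    · nlinarith [hx.1, hx.2]

/-- The frequency `π (j + 1/2)`. -/
def freq (j : ℕ) : ℝ := Real.pi * (j + 1 / 2)

lemma freq_pos (j : ℕ) : 0 < freq j := by
  have := Real.pi_pos
  unfold freq; positivity

lemma freq_strictMono : StrictMono freq := by
  intro i j h
  have h1 : (i : ℝ) < j := by exact_mod_cast h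
  have := Real.pi_pos
  unfold freq
  nlinarith

lemma cos_freq (j : ℕ) : Real.cos (freq j) = 0 := by
  rw [Real.cos_eq_zero_iff]
  exact ⟨j, by unfold freq; push_cast; ring⟩

lemma genCos_neg_sq {ω : ℝ} (hω : 0 < ω) (x : ℝ) : genCos (-ω ^ 2) x = Real.cos (ω * x) := by
  unfold genCos
  rw [if_neg (by nlinarith), neg_neg, Real.sqrt_sq hω.le]

lemma genCos_one_eq_zero_iff (κ : ℝ) : genCos κ 1 = 0 ↔ ∃ j, κ = -freq j ^ 2 := by
  constructor
  · intro h
    unfold genCos at h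
    split_ifs at h with h0
    · exact absurd h (Real.cosh_pos _).ne'
    · rw [mul_one, Real.cos_eq_zero_iff] at h
      obtain ⟨k, hk⟩ := h
      have hs : 0 < Real.sqrt (-κ) := Real.sqrt_pos.2 (by linarith)
      have hk0 : 0 ≤ k := by
        by_contra hneg
        have : (k : ℝ) ≤ -1 := by exact_mod_cast (by omega : k ≤ -1)
        have := Real.pi_pos
        nlinarith
      obtain ⟨j, rfl⟩ := Int.eq_ofNat_of_zero_le hk0
      refine ⟨j, ?_⟩
      have h1 : Real.sqrt (-κ) = freq j := by rw [hk]; unfold freq; push_cast; ring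
      rw [← h1, Real.sq_sqrt (by linarith)]; ring
  · rintro ⟨j, rfl⟩
    rw [genCos_neg_sq (freq_pos j), mul_one, cos_freq]

lemma eq_zero_value_of_hasDerivWithinAt_zero {f : ℝ → ℝ}
    (hf : ∀ x ∈ Icc (0 : ℝ) 1, HasDerivWithinAt f 0 (Icc 0 1) x) {x : ℝ}
    (hx : x ∈ Icc (0 : ℝ) 1) : f x = f 0 := by
  apply constant_of_has_deriv_right_zero (a := 0) (b := 1)
    (fun y hy => (hf y hy).continuousWithinAt) _ x hx
  intro y hy
  exact (hf y ⟨hy.1, hy.2.le⟩).mono_of_mem_nhdsWithin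
    (mem_of_superset (Icc_mem_nhdsGE hy.2) (Icc_subset_Icc_left hy.1))

/-- The Liouville transform of an eigenfunction. -/
lemma IsEigenfunction.genCos_mul_eq {q μ : ℝ} {y : ℝ → ℝ} (hq : -(Real.pi ^ 2 / 4) < q)
    (hy : IsEigenfunction (sigmaConst q) μ y) {x : ℝ} (hx : x ∈ Icc (0 : ℝ) 1) :
    genCos q x * y x = y 0 * genCos (μ + q) x := by
  obtain ⟨⟨p, hyd, hpd, hp0⟩, -, -⟩ := hy
  have hw : ∀ x ∈ Icc (0 : ℝ) 1, HasDerivWithinAt (fun x => genCos q x * y x)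
      (genCosDeriv q x * y x + p x / genCos q x) (Icc 0 1) x := by
    intro x hx
    have hs := (genCos_pos hq hx).ne'
    refine HasDerivWithinAt.congr_deriv
      ((hasDerivAt_genCos q x).hasDerivWithinAt.mul (hyd x hx)) ?_
    rw [sigmaConst_eq_sq]
    field_simp
  have hv : ∀ x ∈ Icc (0 : ℝ) 1, HasDerivWithinAt
      (fun x => genCosDeriv q x * y x + p x / genCos q x)
      ((μ + q) * (genCos q x * y x)) (Icc 0 1) x := by
    intro x hx
    have hs := (genCos_pos hq hx).ne'
    refine HasDerivWithinAt.congr_deriv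
      (((hasDerivAt_genCosDeriv q x).hasDerivWithinAt.mul (hyd x hx)).add
      ((hpd x hx).div (hasDerivAt_genCos q x).hasDerivWithinAt hs)) ?_
    rw [sigmaConst_eq_sq]
    field_simp
    ring
  set κ := μ + q
  have hC : ∀ x, HasDerivWithinAt (genCos κ) (κ * genSin κ x) (Icc 0 1) x := fun x => by
    rw [mul_genSin]; exact (hasDerivAt_genCos κ x).hasDerivWithinAt
  have hS : ∀ x, HasDerivWithinAt (genSin κ) (genCos κ x) (Icc 0 1) x := fun x =>
    (hasDerivAt_genSin κ x).hasDerivWithinAt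
  -- With `w = s y` and `v = w'`, the combinations `w C - v S` and `v C - κ w S` (`C = genCos κ`, `S
  -- = genSin κ`) are constant. Inverting this system, of determinant `C ^ 2 - κ S ^ 2 = 1`, gives
  -- `w` without a uniqueness theorem for differential equations.
  have h1 := eq_zero_value_of_hasDerivWithinAt_zero (f := fun x =>
      (genCos q x * y x) * genCos κ x
        - (genCosDeriv q x * y x + p x / genCos q x) * genSin κ x) (fun x hx => by
    refine HasDerivWithinAt.congr_deriv
      (((hw x hx).mul (hC x)).sub ((hv x hx).mul (hS x))) ?_
    ring) hx
  have h2 := eq_zero_value_of_hasDerivWithinAt_zero (f := fun x =>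
      (genCosDeriv q x * y x + p x / genCos q x) * genCos κ x
        - κ * ((genCos q x * y x) * genSin κ x)) (fun x hx => by
    refine HasDerivWithinAt.congr_deriv
      (((hv x hx).mul (hC x)).sub (((hw x hx).mul (hS x)).const_mul κ)) ?_
    ring) hx
  simp only [genCos_zero, genSin_zero, genCosDeriv_zero, hp0] at h1 h2
  have h3 := genCos_sq_sub κ x
  linear_combination genCos κ x * h1 + genSin κ x * h2 - genCos q x * y x * h3

lemma isEigenfunction_cos {q : ℝ} (hq : -(Real.pi ^ 2 / 4) < q) (j : ℕ) :
    IsEigenfunction (sigmaConst q) (-(freq j ^ 2 + q))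
      (fun x => Real.sqrt 2 * Real.cos (freq j * x) / genCos q x) := by
  have hcos : ∀ x, HasDerivAt (fun x => Real.cos (freq j * x))
      (-(Real.sin (freq j * x) * freq j)) x := fun x => by
    refine HasDerivAt.congr_deriv
      ((Real.hasDerivAt_cos (freq j * x)).comp x ((hasDerivAt_id x).const_mul (freq j))) ?_
    ring
  have hsin : ∀ x, HasDerivAt (fun x => Real.sin (freq j * x))
      (Real.cos (freq j * x) * freq j) x := fun x => by
    refine HasDerivAt.congr_deriv
      ((Real.hasDerivAt_sin (freq j * x)).comp x ((hasDerivAt_id x).const_mul (freq j))) ?_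
    ring
  refine ⟨⟨fun x => Real.sqrt 2 * (-(freq j * Real.sin (freq j * x) * genCos q x)
      - Real.cos (freq j * x) * genCosDeriv q x), fun x hx => ?_, fun x hx => ?_, ?_⟩, ?_, ?_⟩
  · have hs := (genCos_pos hq hx).ne'
    refine HasDerivWithinAt.congr_deriv
      (((((hcos x).const_mul (Real.sqrt 2)).div
      (hasDerivAt_genCos q x) hs)).hasDerivWithinAt) ?_
    rw [sigmaConst_eq_sq]
    field_simp
  · have hs := (genCos_pos hq hx).ne'
    refine HasDerivWithinAt.congr_deriv
      (((((((hsin x).const_mul (freq j)).mul (hasDerivAt_genCos q x)).neg.sub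
      ((hcos x).mul (hasDerivAt_genCosDeriv q x)))).const_mul (Real.sqrt 2)).hasDerivWithinAt) ?_
    rw [sigmaConst_eq_sq]
    field_simp
    ring
  · simp [genCosDeriv_zero]
  · simp [cos_freq]
  · exact ⟨0, by simp, by simp [genCos_zero]⟩

lemma integral_cos_freq_sq (j : ℕ) : ∫ x in (0 : ℝ)..1, Real.cos (freq j * x) ^ 2 = 1 / 2 := by
  have h0 := (freq_pos j).ne'
  rw [intervalIntegral.integral_comp_mul_left (fun x => Real.cos x ^ 2) h0]
  rw [integral_cos_sq]
  simp only [mul_one, mul_zero, cos_freq, Real.sin_zero, smul_eq_mul]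
  field_simp
  ring

/-- The spectral data of `sigmaConst q`. -/
def specData (q : ℝ) : SpectralData where
  δ j := Real.sqrt (freq j ^ 2 + q)
  ξ _ := 2

lemma freq_sq_add_pos {q : ℝ} (hq : -(Real.pi ^ 2 / 4) < q) (j : ℕ) : 0 < freq j ^ 2 + q := by
  have h : freq 0 ≤ freq j := freq_strictMono.monotone (Nat.zero_le j)
  have h0 : freq 0 = Real.pi / 2 := by unfold freq; push_cast; ring
  have := Real.pi_pos
  rw [h0] at h
  nlinarith

lemma specData_delta_sq {q : ℝ} (hq : -(Real.pi ^ 2 / 4) < q) (j : ℕ) :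
    (specData q).δ j ^ 2 = freq j ^ 2 + q :=
  Real.sq_sqrt (freq_sq_add_pos hq j).le

lemma exists_isEigenfunction_iff {q : ℝ} (hq : -(Real.pi ^ 2 / 4) < q) (μ : ℝ) :
    (∃ y, IsEigenfunction (sigmaConst q) μ y) ↔ ∃ j, μ = -(freq j ^ 2 + q) := by
  constructor
  · rintro ⟨y, hy⟩
    obtain ⟨x, hx, hxy⟩ := hy.2.2
    have hy0 : y 0 ≠ 0 := by
      intro h
      have := hy.genCos_mul_eq hq hx
      rw [h, zero_mul] at this
      exact mul_ne_zero (genCos_pos hq hx).ne' hxy this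
    have h1 := hy.genCos_mul_eq hq (right_mem_Icc.2 zero_le_one)
    rw [hy.2.1, mul_zero] at h1
    have h2 : genCos (μ + q) 1 = 0 := by
      rcases mul_eq_zero.1 h1.symm with h | h
      · exact absurd h hy0
      · exact h
    obtain ⟨j, hj⟩ := (genCos_one_eq_zero_iff _).1 h2
    exact ⟨j, by linarith⟩
  · rintro ⟨j, rfl⟩
    exact ⟨_, isEigenfunction_cos hq j⟩

theorem isSpectralData_specData {q : ℝ} (hq : -(Real.pi ^ 2 / 4) < q) :
    IsSpectralData (sigmaConst q) (specData q) where
  pos j := Real.sqrt_pos.2 (freq_sq_add_pos hq j)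
  strictMono i j h := by
    apply Real.sqrt_lt_sqrt (freq_sq_add_pos hq i).le
    have := freq_strictMono h
    have := freq_pos i
    nlinarith
  eigenvalue_iff μ := by
    simp only [specData_delta_sq hq]
    exact exists_isEigenfunction_iff hq μ
  weight j := by
    rw [specData_delta_sq hq]
    refine ⟨_, isEigenfunction_cos hq j, ?_, ?_⟩
    · have : ∫ x in (0 : ℝ)..1,
          (Real.sqrt 2 * Real.cos (freq j * x) / genCos q x) ^ 2 * sigmaConst q x
          = ∫ x in (0 : ℝ)..1, 2 * Real.cos (freq j * x) ^ 2 := by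
        apply intervalIntegral.integral_congr
        intro x hx
        rw [uIcc_of_le zero_le_one] at hx
        have hs := (genCos_pos hq hx).ne'
        simp only [sigmaConst_eq_sq, div_pow, mul_pow, Real.sq_sqrt zero_le_two]
        field_simp
      rw [this, intervalIntegral.integral_const_mul, integral_cos_freq_sq]
      norm_num
    · simp [specData, genCos_zero]

theorem IsSpectralData.eq_specData {q : ℝ} (hq : -(Real.pi ^ 2 / 4) < q) {D : SpectralData}
    (hD : IsSpectralData (sigmaConst q) D) : D = specData q := by
  have h' := isSpectralData_specData hq
  have hmem : ∀ {D₁ D₂ : SpectralData}, IsSpectralData (sigmaConst q) D₁ →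
      IsSpectralData (sigmaConst q) D₂ → range D₁.δ ⊆ range D₂.δ := by
    rintro D₁ D₂ h₁ h₂ _ ⟨j, rfl⟩
    obtain ⟨k, hk⟩ := (h₂.eigenvalue_iff _).1 ((h₁.eigenvalue_iff _).2 ⟨j, rfl⟩)
    refine ⟨k, ?_⟩
    have := (sq_eq_sq₀ (h₁.pos j).le (h₂.pos k).le).1 (by linarith)
    exact this.symm
  -- Two strictly increasing sequences with the same range coincide.
  have hδ : D.δ = (specData q).δ :=
    (hD.strictMono.range_inj h'.strictMono).1 ((hmem hD h').antisymm (hmem h' hD))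
  refine SpectralData.ext hδ ?_
  funext j
  obtain ⟨y, hy, hint, hξ⟩ := hD.weight j
  rw [hδ, specData_delta_sq hq] at hy
  have hcongr : ∫ x in (0 : ℝ)..1, y x ^ 2 * sigmaConst q x
      = ∫ x in (0 : ℝ)..1, y 0 ^ 2 * Real.cos (freq j * x) ^ 2 := by
    apply intervalIntegral.integral_congr
    intro x hx
    rw [uIcc_of_le zero_le_one] at hx
    have h1 := hy.genCos_mul_eq hq hx
    rw [show -(freq j ^ 2 + q) + q = -freq j ^ 2 by ring, genCos_neg_sq (freq_pos j)] at h1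
    simp only [sigmaConst_eq_sq, ← mul_pow, ← h1]
    ring
  rw [hcongr, intervalIntegral.integral_const_mul, integral_cos_freq_sq] at hint
  rw [hξ]
  show y 0 ^ 2 = 2
  linarith

/-! ### The difference operator as a staggered first-order system. -/

/-- The staggered (first order) form of the difference equation with coefficients `c` and
spectral parameter `μ`: `y` lives on the primary grid, and the flux `w` on the dual grid. -/
structure IsStaggeredSolution {ℓ : ℕ} (c : Coeffs ℓ) (μ : ℝ) (y w : ℕ → ℝ) : Prop where
  flux_zero : w 0 = 0
  prim_eq : ∀ i : Fin ℓ, c.prim i * w (i + 1) = y (i + 1) - y i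
  dual_eq : ∀ i : Fin ℓ, w (i + 1) - w i = μ * c.dual i * y i

lemma sum_ite_val_eq {ℓ : ℕ} (f : Fin ℓ → ℝ) {n : ℕ} (hn : n < ℓ) :
    (∑ k : Fin ℓ, if k.val = n then f k else 0) = f ⟨n, hn⟩ := by
  rw [Finset.sum_eq_single ⟨n, hn⟩]
  · simp
  · intro k _ hk
    rw [if_neg]
    intro h
    exact hk (Fin.ext h)
  · simp

lemma sum_ite_val_eq_zero {ℓ : ℕ} (f : Fin ℓ → ℝ) {n : ℕ} (hn : ¬ n < ℓ) :
    (∑ k : Fin ℓ, if k.val = n then f k else 0) = 0 := by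
  apply Finset.sum_eq_zero
  intro k _
  rw [if_neg]
  have := k.2
  omega

/-- Extending vectors to `ℕ → ℝ` with `y ℓ = 0` encodes the Dirichlet condition, so the last row
needs no separate formula. -/
lemma jacobiMatrix_mulVec {ℓ : ℕ} (c : Coeffs ℓ) {y : ℕ → ℝ} (hy : y ℓ = 0) (i : Fin ℓ) :
    (jacobiMatrix c).mulVec (fun j => y j) i =
      1 / c.dual i * ((y (i + 1) - y i) / c.prim i
        - ∑ k : Fin ℓ, if k.val + 1 = i.val then (y i - y k) / c.prim k else 0) := by
  have hsplit : ∀ j : Fin ℓ, jacobiMatrix c i j * y j =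
      (if j.val = i.val then -(1 / c.dual j) *
        (1 / c.prim j + ∑ k : Fin ℓ, if k.val + 1 = i.val then 1 / c.prim k else 0) * y j else 0)
      + (if j.val = i.val + 1 then 1 / (c.dual i * c.prim i) * y j else 0)
      + (if j.val + 1 = i.val then 1 / (c.dual i * c.prim j) * y j else 0) := by
    intro j
    simp only [jacobiMatrix, Matrix.of_apply, Fin.ext_iff]
    by_cases h1 : j.val = i.val
    · have : j = i := Fin.ext h1
      subst this
      simp
    · by_cases h2 : j.val = i.val + 1
      · have h3 : ¬ (j.val + 1 = i.val) := by omega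
        simp only [h2, if_true]
        have h4 : ¬ (i.val + 1 + 1 = i.val) := by omega
        have h5 : ¬ (i.val + 1 = i.val) := by omega
        simp [h4]
      · simp only [h1, h2, if_false]
        split_ifs <;> ring
  simp only [Matrix.mulVec, dotProduct]
  rw [Finset.sum_congr rfl fun j _ => hsplit j, Finset.sum_add_distrib, Finset.sum_add_distrib,
    sum_ite_val_eq _ i.2]
  have h2 : (∑ j : Fin ℓ, if j.val = i.val + 1 then 1 / (c.dual i * c.prim i) * y j else 0)
      = 1 / (c.dual i * c.prim i) * y (i + 1) := by
    by_cases h : i.val + 1 < ℓ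
    · rw [sum_ite_val_eq _ h]
    · rw [sum_ite_val_eq_zero _ h, show i.val + 1 = ℓ by omega, hy, mul_zero]
  have h3 : (∑ j : Fin ℓ, if j.val + 1 = i.val then 1 / (c.dual i * c.prim j) * y j else 0)
      = 1 / c.dual i * ∑ k : Fin ℓ, if k.val + 1 = i.val then y k / c.prim k else 0 := by
    rw [Finset.mul_sum]
    refine Finset.sum_congr rfl fun k _ => ?_
    split_ifs
    · field_simp
    · simp
  have h4 : (∑ k : Fin ℓ, if k.val + 1 = i.val then (y i - y k) / c.prim k else 0)
      = y i * (∑ k : Fin ℓ, if k.val + 1 = i.val then 1 / c.prim k else 0)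
        - ∑ k : Fin ℓ, if k.val + 1 = i.val then y k / c.prim k else 0 := by
    rw [Finset.mul_sum, ← Finset.sum_sub_distrib]
    refine Finset.sum_congr rfl fun k _ => ?_
    split_ifs
    · ring
    · simp
  rw [h2, h3, h4]
  simp only [Fin.eta]
  ring

/-- The flux of a grid function. -/
def gridFlux {ℓ : ℕ} (c : Coeffs ℓ) (y : ℕ → ℝ) (n : ℕ) : ℝ :=
  ∑ k : Fin ℓ, if k.val + 1 = n then (y n - y k) / c.prim k else 0

lemma gridFlux_succ {ℓ : ℕ} (c : Coeffs ℓ) (y : ℕ → ℝ) (i : Fin ℓ) :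
    gridFlux c y (i + 1) = (y (i + 1) - y i) / c.prim i := by
  unfold gridFlux
  simp only [add_left_inj]
  rw [sum_ite_val_eq _ i.2]

lemma IsStaggeredSolution.eq_gridFlux {ℓ : ℕ} {c : Coeffs ℓ} (hc : ∀ i, 0 < c.prim i) {μ : ℝ}
    {y w : ℕ → ℝ} (h : IsStaggeredSolution c μ y w) {n : ℕ} (hn : n ≤ ℓ) :
    w n = gridFlux c y n := by
  cases n with
  | zero => simp [h.flux_zero, gridFlux]
  | succ n =>
    have h1 := h.prim_eq ⟨n, hn⟩
    rw [gridFlux_succ c y ⟨n, hn⟩, ← h1]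
    have := (hc ⟨n, hn⟩).ne'
    field_simp

lemma IsStaggeredSolution.mulVec {ℓ : ℕ} {c : Coeffs ℓ} (hp : ∀ i, 0 < c.prim i)
    (hd : ∀ i, 0 < c.dual i) {μ : ℝ} {y w : ℕ → ℝ} (h : IsStaggeredSolution c μ y w)
    (hy : y ℓ = 0) :
    (jacobiMatrix c).mulVec (fun j => y j) = μ • fun j : Fin ℓ => y j := by
  funext i
  have h1 := h.eq_gridFlux hp i.2.le
  have h2 := h.eq_gridFlux hp i.2
  have h3 := h.dual_eq i
  rw [Nat.succ_eq_add_one, gridFlux_succ] at h2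
  unfold gridFlux at h1
  rw [jacobiMatrix_mulVec c hy, ← h2, ← h1, h3]
  have := (hd i).ne'
  simp only [Pi.smul_apply, smul_eq_mul]
  field_simp

lemma IsStaggeredSolution.of_mulVec {ℓ : ℕ} {c : Coeffs ℓ} (hp : ∀ i, 0 < c.prim i)
    (hd : ∀ i, 0 < c.dual i) {μ : ℝ} {y : ℕ → ℝ} (hy : y ℓ = 0)
    (h : (jacobiMatrix c).mulVec (fun j => y j) = μ • fun j : Fin ℓ => y j) :
    IsStaggeredSolution c μ y (gridFlux c y) where
  flux_zero := by simp [gridFlux]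
  prim_eq i := by
    have := (hp i).ne'
    rw [gridFlux_succ]
    field_simp
  dual_eq i := by
    have h1 := congrFun h i
    rw [jacobiMatrix_mulVec c hy, ← gridFlux_succ] at h1
    have := (hd i).ne'
    simp only [Pi.smul_apply, smul_eq_mul] at h1
    rw [mul_right_comm, ← h1]
    unfold gridFlux
    field_simp

lemma IsStaggeredSolution.const_mul {ℓ : ℕ} {c : Coeffs ℓ} {μ : ℝ} {y w : ℕ → ℝ}
    (h : IsStaggeredSolution c μ y w) (a : ℝ) :
    IsStaggeredSolution c μ (fun n => a * y n) (fun n => a * w n) where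
  flux_zero := by simp [h.flux_zero]
  prim_eq i := by linear_combination a * h.prim_eq i
  dual_eq i := by linear_combination a * h.dual_eq i

/-- One step of the discrete Green identity. -/
lemma IsStaggeredSolution.wronskian_step {ℓ : ℕ} {c : Coeffs ℓ} {μ ν : ℝ} {y w z v : ℕ → ℝ}
    (h : IsStaggeredSolution c μ y w) (k : IsStaggeredSolution c ν z v) (i : Fin ℓ) :
    (w (i + 1) * z (i + 1) - v (i + 1) * y (i + 1)) - (w i * z i - v i * y i) =
      (μ - ν) * (c.dual i * y i * z i) := by
  linear_combination z i * h.dual_eq i - y i * k.dual_eq i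
    + v (i + 1) * h.prim_eq i - w (i + 1) * k.prim_eq i

lemma IsStaggeredSolution.green {ℓ : ℕ} {c : Coeffs ℓ} {μ ν : ℝ} {y w z v : ℕ → ℝ}
    (h : IsStaggeredSolution c μ y w) (k : IsStaggeredSolution c ν z v) :
    w ℓ * z ℓ - v ℓ * y ℓ = (μ - ν) * ∑ i : Fin ℓ, c.dual i * y i * z i := by
  rw [Finset.mul_sum, ← Finset.sum_congr rfl fun i _ => h.wronskian_step k i,
    Fin.sum_univ_eq_sum_range
      (fun i => (w (i + 1) * z (i + 1) - v (i + 1) * y (i + 1)) - (w i * z i - v i * y i)) ℓ,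
    Finset.sum_range_sub (fun i => w i * z i - v i * y i), h.flux_zero, k.flux_zero]
  ring

lemma IsStaggeredSolution.orthogonal {ℓ : ℕ} {c : Coeffs ℓ} {μ ν : ℝ} {y w z v : ℕ → ℝ}
    (h : IsStaggeredSolution c μ y w) (k : IsStaggeredSolution c ν z v) (hy : y ℓ = 0)
    (hz : z ℓ = 0) (hne : μ ≠ ν) : ∑ i : Fin ℓ, c.dual i * y i * z i = 0 := by
  have := h.green k
  rw [hy, hz, mul_zero, mul_zero, sub_zero] at this
  rcases mul_eq_zero.1 this.symm with h | h
  · exact absurd (sub_eq_zero.1 h) hne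
  · exact h

/-! ### The discrete inverse problem: uniqueness and grid length. -/

/-- A system of eigenvectors with its fluxes, in a normalized form that depends on the data and
the coefficients only. -/
lemma SolvesInverse.exists_eigenbasis {D : SpectralData} {ℓ : ℕ} {c : Coeffs ℓ}
    (h : SolvesInverse D c) (hD : Function.Injective fun j => -(D.δ j) ^ 2) :
    ∃ Y W : Fin ℓ → ℕ → ℝ,
      (∀ j : Fin ℓ, IsStaggeredSolution c (-(D.δ j) ^ 2) (Y j) (W j)) ∧ (∀ j, Y j ℓ = 0) ∧
      (∀ j, 0 < ℓ → Y j 0 = Real.sqrt (D.ξ j)) ∧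
      (∀ j, 0 < ℓ → Y j 0 ^ 2 = D.ξ j) ∧
      ∀ p r : Fin ℓ, c.dual p * ∑ j, Y j p * Y j r = if p = r then 1 else 0 := by
  have key : ∀ j : Fin ℓ, ∃ y w : ℕ → ℝ, IsStaggeredSolution c (-(D.δ j) ^ 2) y w ∧ y ℓ = 0 ∧
      (0 < ℓ → y 0 = Real.sqrt (D.ξ j)) ∧ (0 < ℓ → y 0 ^ 2 = D.ξ j) ∧
      ∑ p : Fin ℓ, c.dual p * y p * y p = 1 := by
    intro j
    obtain ⟨Y, hY, hnorm, h0⟩ := h.spectrum j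
    set y : ℕ → ℝ := fun n => if hn : n < ℓ then Y ⟨n, hn⟩ else 0 with hy
    have hyY : (fun p : Fin ℓ => y p) = Y := by
      funext p
      simp [hy]
    have hyℓ : y ℓ = 0 := by simp [hy]
    have hsol := IsStaggeredSolution.of_mulVec (μ := -(D.δ j) ^ 2) h.prim_pos h.dual_pos hyℓ
      (by rw [hyY, hY])
    have hsq : 0 < ℓ → y 0 ^ 2 = D.ξ j := fun hℓ => by
      rw [← h0 ⟨0, hℓ⟩ rfl, ← hyY]
    have hn : ∑ p : Fin ℓ, c.dual p * y p * y p = 1 := by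
      rw [← hnorm, ← hyY]
      exact Finset.sum_congr rfl fun p _ => by ring
    -- The data fix only `y 0 ^ 2`; the sign is chosen so that `y 0` is the nonnegative root.
    rcases le_total 0 (y 0) with hs | hs
    · exact ⟨y, _, hsol, hyℓ, fun hℓ => by rw [← hsq hℓ, Real.sqrt_sq hs], hsq, hn⟩
    · refine ⟨_, _, hsol.const_mul (-1), by simp [hyℓ], fun hℓ => ?_, fun hℓ => ?_, ?_⟩
      · rw [← hsq hℓ, ← neg_sq, Real.sqrt_sq (by linarith)]
        ring
      · rw [← hsq hℓ]
        ring
      · exact (Finset.sum_congr rfl fun p _ => by ring).trans hn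
  choose Y W hsol hYℓ h0 hsq hn using key
  refine ⟨Y, W, hsol, hYℓ, h0, hsq, ?_⟩
  let A : Matrix (Fin ℓ) (Fin ℓ) ℝ := Matrix.of fun j p => Y j p
  let B : Matrix (Fin ℓ) (Fin ℓ) ℝ := Matrix.of fun p j => c.dual p * Y j p
  have hAB : A * B = 1 := by
    ext j k
    have hAB' : (A * B) j k = ∑ p : Fin ℓ, c.dual p * Y j p * Y k p := by
      rw [Matrix.mul_apply]
      exact Finset.sum_congr rfl fun p _ => by simp only [A, B, Matrix.of_apply]; ring
    rw [hAB', Matrix.one_apply]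
    split_ifs with hjk
    · subst hjk
      exact hn j
    · exact (hsol j).orthogonal (hsol k) (hYℓ j) (hYℓ k)
        fun he => hjk (Fin.ext (hD he))
  -- For square matrices, orthonormality of the eigenvectors over the grid becomes orthogonality
  -- over the eigenvalue index.
  have hBA : B * A = 1 := mul_eq_one_comm.1 hAB
  intro p r
  have := congrFun (congrFun hBA p) r
  rw [Matrix.mul_apply, Matrix.one_apply] at this
  rw [← this, Finset.mul_sum]
  exact Finset.sum_congr rfl fun j _ => by simp only [A, B, Matrix.of_apply]; ring

/-- A Lanczos recursion: the values and fluxes of all eigenvectors at node `i` determine `α̂_i` by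
normalization, then the next flux, then `α_i` by orthogonality of neighbouring nodes, then the next
values. The starting values are `√ξ_j` and `0`. -/
theorem SolvesInverse.unique {D : SpectralData} {ℓ : ℕ} {c c' : Coeffs ℓ}
    (h : SolvesInverse D c) (h' : SolvesInverse D c')
    (hD : Function.Injective fun j => -(D.δ j) ^ 2) : c = c' := by
  obtain ⟨Y, W, hsol, hYℓ, h0, -, horth⟩ := h.exists_eigenbasis hD
  obtain ⟨Y', W', hsol', hYℓ', h0', -, horth'⟩ := h'.exists_eigenbasis hD
  have step : ∀ i : Fin ℓ, (∀ j, Y j i = Y' j i ∧ W j i = W' j i) →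
      c.dual i = c'.dual i ∧ c.prim i = c'.prim i ∧
        ∀ j, Y j (i + 1) = Y' j (i + 1) ∧ W j (i + 1) = W' j (i + 1) := by
    intro i hi
    have hdual : ∀ {c : Coeffs ℓ} {Y W : Fin ℓ → ℕ → ℝ}, SolvesInverse D c →
        (∀ j : Fin ℓ, IsStaggeredSolution c (-(D.δ j) ^ 2) (Y j) (W j)) → (∀ j, Y j ℓ = 0) →
        (∀ p r : Fin ℓ, c.dual p * ∑ j, Y j p * Y j r = if p = r then 1 else 0) →
        c.dual i * c.prim i * ∑ j, W j (i + 1) * Y j i = -1 := by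
      intro c Y W hc hs hℓ ho
      have h1 := ho i i
      rw [if_pos rfl] at h1
      -- Orthogonality of neighbouring nodes inside the grid; at the last node the Dirichlet
      -- condition gives the same identity.
      have h2 : ∑ j, Y j (i + 1) * Y j i = 0 := by
        by_cases hlt : i.val + 1 < ℓ
        · have h3 := ho ⟨i + 1, hlt⟩ i
          rw [if_neg (by simp [Fin.ext_iff])] at h3
          rcases mul_eq_zero.1 h3 with h4 | h4
          · exact absurd h4 (hc.dual_pos _).ne'
          · exact h4
        · rw [show i.val + 1 = ℓ by omega]
          simp [hℓ]
      have h3 : c.prim i * ∑ j, W j (i + 1) * Y j i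
          = ∑ j, Y j (i + 1) * Y j i - ∑ j, Y j i * Y j i := by
        rw [Finset.mul_sum, ← Finset.sum_sub_distrib]
        exact Finset.sum_congr rfl fun j _ => by linear_combination Y j i * (hs j).prim_eq i
      rw [mul_assoc, h3, h2]
      linarith
    have hd : c.dual i = c'.dual i := by
      have h1 := horth i i
      have h2 := horth' i i
      rw [if_pos rfl] at h1 h2
      simp only [fun j => (hi j).1] at h1
      have : (∑ j, Y' j i * Y' j i) ≠ 0 := by
        intro h0
        rw [h0, mul_zero] at h2
        exact zero_ne_one h2
      exact mul_right_cancel₀ this (h1.trans h2.symm)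
    have hW : ∀ j, W j (i + 1) = W' j (i + 1) := fun j => by
      have h1 := (hsol j).dual_eq i
      have h2 := (hsol' j).dual_eq i
      rw [← hd, ← (hi j).1, ← (hi j).2] at h2
      linarith
    have hp : c.prim i = c'.prim i := by
      have h1 := hdual h hsol hYℓ horth
      have h2 := hdual h' hsol' hYℓ' horth'
      simp only [hW, fun j => (hi j).1, hd] at h1
      have hne : c'.dual i * ∑ j, W' j (i + 1) * Y' j i ≠ 0 := by
        intro h0
        rw [mul_right_comm, h0, zero_mul] at h2
        norm_num at h2
      apply mul_right_cancel₀ hne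
      linarith
    refine ⟨hd, hp, fun j => ⟨?_, hW j⟩⟩
    have h1 := (hsol j).prim_eq i
    have h2 := (hsol' j).prim_eq i
    rw [hp, hW, (hi j).1] at h1
    linarith
  have hall : ∀ n, (hn : n < ℓ) → ∀ j, Y j n = Y' j n ∧ W j n = W' j n := by
    intro n
    induction n with
    | zero =>
      intro hn j
      exact ⟨by rw [h0 j hn, h0' j hn], by rw [(hsol j).flux_zero, (hsol' j).flux_zero]⟩
    | succ n ih =>
      intro hn
      exact (step ⟨n, by omega⟩ (ih (by omega))).2.2
  exact Coeffs.ext (funext fun i => (step i (hall i i.2)).2.1)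
    (funext fun i => (step i (hall i i.2)).1)

/-- The length of the primary grid (the Stieltjes continued fraction at the origin). -/
theorem SolvesInverse.sum_prim {D : SpectralData} {ℓ : ℕ} {c : Coeffs ℓ}
    (h : SolvesInverse D c) (hD : Function.Injective fun j => -(D.δ j) ^ 2)
    (hpos : ∀ j, D.δ j ≠ 0) :
    ∑ i, c.prim i = ∑ j : Fin ℓ, D.ξ j / (D.δ j) ^ 2 := by
  rcases Nat.eq_zero_or_pos ℓ with hℓ | hℓ
  · subst hℓ
    simp
  obtain ⟨Y, W, hsol, hYℓ, -, hsq, horth⟩ := h.exists_eigenbasis hD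
  -- The function `u_i = ∑ j, Y j 0 * Y j i / δ_j ^ 2` is the Green function with source at the
  -- first node. Its flux is constantly `-1`, so `u_i - u_{i+1} = α_i`, and telescoping gives `∑ α_i
  -- = u_0`.
  have hflux : ∀ n, n < ℓ → ∑ j : Fin ℓ, Y j 0 * W j (n + 1) / (D.δ j) ^ 2 = -1 := by
    have hs : ∀ i : Fin ℓ, ∑ j : Fin ℓ, Y j 0 * W j (i + 1) / (D.δ j) ^ 2
        = ∑ j : Fin ℓ, Y j 0 * W j i / (D.δ j) ^ 2
          - if i = ⟨0, hℓ⟩ then 1 else 0 := by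
      intro i
      rw [← horth i ⟨0, hℓ⟩, Finset.mul_sum, ← Finset.sum_sub_distrib]
      refine Finset.sum_congr rfl fun j _ => ?_
      have h1 := (hsol j).dual_eq i
      have h2 := hpos j
      rw [show W j (i + 1) = W j i + -D.δ j ^ 2 * c.dual i * Y j i by linarith]
      field_simp
      ring
    intro n
    induction n with
    | zero =>
      intro hn
      have := hs ⟨0, hn⟩
      simpa [(hsol _).flux_zero] using this
    | succ n ih =>
      intro hn
      have := hs ⟨n + 1, hn⟩
      rw [if_neg (by simp [Fin.ext_iff])] at this
      simp only at this
      rw [this, ih (by omega)]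
      ring
  have hdiff : ∀ i : Fin ℓ,
      c.prim i = ∑ j : Fin ℓ, (Y j 0 * Y j i - Y j 0 * Y j (i + 1)) / (D.δ j) ^ 2 := by
    intro i
    have h1 := hflux i i.2
    have h2 : ∑ j : Fin ℓ, (Y j 0 * Y j i - Y j 0 * Y j (i + 1)) / (D.δ j) ^ 2
        = -c.prim i * ∑ j : Fin ℓ, Y j 0 * W j (i + 1) / (D.δ j) ^ 2 := by
      rw [Finset.mul_sum]
      refine Finset.sum_congr rfl fun j _ => ?_
      rw [← mul_sub, ← neg_sub (Y j (i + 1)), ← (hsol j).prim_eq i]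
      ring
    rw [h2, h1]
    ring
  rw [Finset.sum_congr rfl fun i _ => hdiff i, Finset.sum_comm]
  refine Finset.sum_congr rfl fun j _ => ?_
  rw [← Finset.sum_div, Fin.sum_univ_eq_sum_range
    (fun i => Y j 0 * Y j i - Y j 0 * Y j (i + 1)) ℓ,
    Finset.sum_range_sub' (fun i => Y j 0 * Y j i), hYℓ, ← hsq j hℓ]
  ring

/-! ### Gram polynomials: structure relations, zeros and sums. -/

/-- The discrete Chebyshev (Gram) polynomials for `N` points, in the variable centred at the
midpoint of the `N` points. -/
def gram (N : ℝ) : ℕ → ℝ → ℝ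
  | 0, _ => 1
  | 1, x => 2 * x
  | n + 2, x =>
    (2 * (2 * n + 3) * x * gram N (n + 1) x
      - (n + 1) * (N ^ 2 - (n + 1) ^ 2) * gram N n x) / (n + 2)

lemma gram_add_two (N : ℝ) (n : ℕ) (x : ℝ) :
    (n + 2) * gram N (n + 2) x = 2 * (2 * n + 3) * x * gram N (n + 1) x
      - (n + 1) * (N ^ 2 - (n + 1) ^ 2) * gram N n x := by
  have : (n + 2 : ℝ) ≠ 0 := by positivity
  rw [gram]
  field_simp

lemma gram_neg (N x : ℝ) : ∀ n : ℕ, gram N n (-x) = (-1) ^ n * gram N n x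
  | 0 => by simp [gram]
  | 1 => by simp [gram]
  | n + 2 => by
    rw [gram, gram, gram_neg N x n, gram_neg N x (n + 1)]
    ring

/-- The backward structure relation. -/
lemma gram_structure_backward (N y : ℝ) : ∀ n : ℕ,
    (y ^ 2 - N ^ 2 / 4) * (gram N (n + 1) (y + 1 / 2) - gram N (n + 1) (y - 1 / 2)) =
      (n + 1) / 2 * ((2 * y - (n + 1)) * gram N (n + 1) (y + 1 / 2)
        - (N ^ 2 - (n + 1) ^ 2) * gram N n (y + 1 / 2))
  | 0 => by simp [gram]; ring
  | 1 => by simp [gram]; ring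
  | n + 2 => by
    have h1 := gram_structure_backward N y n
    have h2 := gram_structure_backward N y (n + 1)
    have r1 := gram_add_two N n (y + 1 / 2)
    have r2 := gram_add_two N (n + 1) (y + 1 / 2)
    have r3 := gram_add_two N (n + 1) (y - 1 / 2)
    have hn : (n + 3 : ℝ) ≠ 0 := by positivity
    apply mul_left_cancel₀ hn
    push_cast at *
    linear_combination (2 * (2 * n + 5) * (y - 1 / 2)) * h2 - (n + 2) * (N ^ 2 - (n + 2) ^ 2) * h1
      + (y ^ 2 - N ^ 2 / 4 - (n + 3) / 2 * (2 * y - (n + 3))) * r2 - (y ^ 2 - N ^ 2 / 4) * r3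
      + (n + 2) * (N ^ 2 - (n + 2) ^ 2) / 2 * r1

/-- The reflection `y ↦ -y` of the backward relation, by parity. -/
lemma gram_structure_forward (N y : ℝ) (n : ℕ) :
    (y ^ 2 - N ^ 2 / 4) * (gram N (n + 1) (y + 1 / 2) - gram N (n + 1) (y - 1 / 2)) =
      (n + 1) / 2 * ((2 * y + (n + 1)) * gram N (n + 1) (y - 1 / 2)
        - (N ^ 2 - (n + 1) ^ 2) * gram N n (y - 1 / 2)) := by
  have h := gram_structure_backward N (-y) n
  rw [show -y + 1 / 2 = -(y - 1 / 2) by ring, show -y - 1 / 2 = -(y + 1 / 2) by ring] at h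
  simp only [gram_neg] at h
  rcases neg_one_pow_eq_or ℝ n with h1 | h1 <;> simp only [pow_succ, h1] at h <;> linarith

/-- Subtracting the backward relation at `x - 1/2` from the forward one at `x + 1/2` cancels the
lower-degree polynomial. The divergence form on the left is what later telescopes. -/
lemma gram_difference_equation (N x : ℝ) (n : ℕ) :
    ((x + 1 / 2) ^ 2 - N ^ 2 / 4) * (gram N n (x + 1) - gram N n x)
      - ((x - 1 / 2) ^ 2 - N ^ 2 / 4) * (gram N n x - gram N n (x - 1)) =
      n * (n + 1) * gram N n x := by
  cases n with
  | zero => simp [gram]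
  | succ n =>
    have h1 := gram_structure_backward N (x - 1 / 2) n
    have h2 := gram_structure_forward N (x + 1 / 2) n
    rw [show x - 1 / 2 + 1 / 2 = x by ring, show x - 1 / 2 - 1 / 2 = x - 1 by ring] at h1
    rw [show x + 1 / 2 + 1 / 2 = x + 1 by ring, show x + 1 / 2 - 1 / 2 = x by ring] at h2
    push_cast
    linear_combination h2 - h1


/-- In degree `N` the coefficient `N ^ 2 - (n + 1) ^ 2` vanishes, and the structure relation links
only neighbouring points; its factor `k` starts the chain with the value zero. This supplies the
Dirichlet condition of the eigenvectors. -/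
lemma gram_node_eq_zero (N : ℕ) (k : ℕ) (hk : k < N) :
    gram N N (-(N : ℝ) / 2 + 1 / 2 + k) = 0 := by
  obtain ⟨n, rfl⟩ : ∃ n, N = n + 1 := ⟨N - 1, by omega⟩
  have step : ∀ k : ℕ, k < n + 1 →
      ((k : ℝ) - (n + 1 : ℕ)) * gram (n + 1 : ℕ) (n + 1) (-((n + 1 : ℕ) : ℝ) / 2 + 1 / 2 + k) =
        k * gram (n + 1 : ℕ) (n + 1) (-((n + 1 : ℕ) : ℝ) / 2 - 1 / 2 + k) := by
    intro k hk
    have hk' : (k : ℝ) - (n + 1 : ℕ) ≠ 0 := by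
      have : (k : ℝ) < (n + 1 : ℕ) := by exact_mod_cast hk
      linarith
    have h := gram_structure_backward (n + 1 : ℕ) (-((n + 1 : ℕ) : ℝ) / 2 + k) n
    apply mul_left_cancel₀ hk'
    rw [show -((n + 1 : ℕ) : ℝ) / 2 + k + 1 / 2 = -((n + 1 : ℕ) : ℝ) / 2 + 1 / 2 + k by ring,
      show -((n + 1 : ℕ) : ℝ) / 2 + k - 1 / 2 = -((n + 1 : ℕ) : ℝ) / 2 - 1 / 2 + k by ring] at h
    push_cast at h ⊢
    linear_combination h
  have hne : ∀ k : ℕ, k < n + 1 → (k : ℝ) - (n + 1 : ℕ) ≠ 0 := fun k hk => by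
    have : (k : ℝ) < (n + 1 : ℕ) := by exact_mod_cast hk
    linarith
  induction k with
  | zero =>
    have h := step 0 hk
    rw [Nat.cast_zero, zero_mul] at h
    simpa [(hne 0 hk)] using (mul_eq_zero.1 h).resolve_left (by simpa using hne 0 hk)
  | succ k ih =>
    have h := step (k + 1) hk
    rw [show -((n + 1 : ℕ) : ℝ) / 2 - 1 / 2 + (k + 1 : ℕ)
      = -((n + 1 : ℕ) : ℝ) / 2 + 1 / 2 + k by push_cast; ring, ih (by omega), mul_zero] at h
    exact (mul_eq_zero.1 h).resolve_left (hne _ hk)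

/-- The difference equation telescopes: the boundary term at `0` vanishes by evenness, and the one
at `ℓ` because its coefficient is zero. -/
lemma sum_gram_even (ℓ i : ℕ) :
    ∑ j ∈ Finset.range ℓ, gram (2 * ℓ) (2 * (i + 1)) (j + 1 / 2) = 0 := by
  set F : ℕ → ℝ := fun j => ((j : ℝ) ^ 2 - (2 * ℓ) ^ 2 / 4) *
    (gram (2 * ℓ) (2 * (i + 1)) (j + 1 / 2) - gram (2 * ℓ) (2 * (i + 1)) (j - 1 / 2)) with hF
  have hstep : ∀ j : ℕ, ((2 * (i + 1) : ℕ) : ℝ) * ((2 * (i + 1) : ℕ) + 1) *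
      gram (2 * ℓ) (2 * (i + 1)) (j + 1 / 2) = F (j + 1) - F j := by
    intro j
    have h := gram_difference_equation (2 * ℓ) (j + 1 / 2) (2 * (i + 1))
    rw [← h]
    simp only [hF]
    push_cast
    rw [show (j : ℝ) + 1 / 2 + 1 / 2 = j + 1 by ring, show (j : ℝ) + 1 / 2 - 1 / 2 = j by ring,
      show (j : ℝ) + 1 / 2 + 1 = j + 1 + 1 / 2 by ring,
      show (j : ℝ) + 1 / 2 - 1 = j - 1 / 2 by ring,
      show (j : ℝ) + 1 - 1 / 2 = j + 1 / 2 by ring]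
  have h0 : F 0 = 0 := by
    simp only [hF, Nat.cast_zero]
    rw [show (0 : ℝ) - 1 / 2 = -(0 + 1 / 2) by ring, gram_neg, pow_mul]
    simp
  have hℓ : F ℓ = 0 := by
    simp only [hF]
    ring
  have hne : ((2 * (i + 1) : ℕ) : ℝ) * ((2 * (i + 1) : ℕ) + 1) ≠ 0 := by positivity
  apply mul_left_cancel₀ hne
  rw [Finset.mul_sum, Finset.sum_congr rfl fun j _ => hstep j, Finset.sum_range_sub, h0, hℓ]
  simp

/-- At `y = 0` parity removes the reflected values from the structure relations. The resulting
recursion yields positivity of the first eigenvector. -/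
lemma gram_even_half (N : ℝ) (i : ℕ) (hi : N ^ 2 - (2 * i + 1) ^ 2 ≠ 0) :
    gram N (2 * (i + 1)) (1 / 2) =
      -((N ^ 2 - (2 * i + 2) ^ 2) * (2 * i + 1) / (2 * i + 2)) * gram N (2 * i) (1 / 2) := by
  have h1 := gram_structure_backward N 0 (2 * i)
  have h2 := gram_structure_backward N 0 (2 * i + 1)
  have hodd : gram N (2 * i + 1) (-(1 / 2)) = -gram N (2 * i + 1) (1 / 2) := by
    rw [gram_neg, pow_succ, pow_mul]
    simp
  have heven : gram N (2 * i + 1 + 1) (-(1 / 2)) = gram N (2 * i + 1 + 1) (1 / 2) := by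
    rw [gram_neg, show 2 * i + 1 + 1 = 2 * (i + 1) by ring, pow_mul]
    simp
  rw [zero_add, zero_sub, hodd] at h1
  rw [zero_add, zero_sub, heven] at h2
  push_cast at h1 h2
  have h3 : gram N (2 * i + 1) (1 / 2) = (2 * i + 1) * gram N (2 * i) (1 / 2) := by
    apply mul_left_cancel₀ hi
    linear_combination -2 * h1
  rw [h3] at h2
  have h4 : (2 * i + 2 : ℝ) ≠ 0 := by positivity
  have h5 : (2 * i + 2) * gram N (2 * i + 1 + 1) (1 / 2) =
      -((N ^ 2 - (2 * i + 2) ^ 2) * (2 * i + 1) * gram N (2 * i) (1 / 2)) := by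
    apply mul_left_cancel₀ h4
    linear_combination 2 * h2
  rw [show 2 * (i + 1) = 2 * i + 1 + 1 by ring, ← mul_right_inj' h4, h5]
  field_simp

/-! ### The optimal grid and its eigenvectors. -/

/-- The normalization factors of the Gram polynomials. -/
def gramScale (N : ℝ) : ℕ → ℝ
  | 0 => 1
  -- This makes the first step `1 / N`; for `N = 2 * ℓ` the normalization forces `α̂_1 = 1 / ∑ ξ_j =
  -- 1 / (2 * ℓ)`.
  | 1 => 2 * N / Real.pi
  -- The factor that turns the lower coefficient of the recurrence into `1`.
  | n + 2 => gramScale N n * ((n + 1) * (N ^ 2 - (n + 1) ^ 2) / (n + 2))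

lemma gramScale_pos {N : ℝ} (hN : 0 < N) : ∀ n : ℕ, (n : ℝ) ≤ N → 0 < gramScale N n
  | 0, _ => by simp [gramScale]
  | 1, _ => by
    have := Real.pi_pos
    simp only [gramScale]
    positivity
  | n + 2, h => by
    push_cast at h
    have h0 := gramScale_pos hN n (by linarith)
    have h1 : 0 < N ^ 2 - (n + 1 : ℝ) ^ 2 := by
      have : (0 : ℝ) ≤ n := Nat.cast_nonneg n
      nlinarith
    simp only [gramScale]
    positivity

/-- The steps of the optimal grid, with the dual and the primary steps interlaced. -/
def optimalStep (N : ℝ) (n : ℕ) : ℝ :=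
  2 * (2 * n + 1) * gramScale N n / ((n + 1) * Real.pi * gramScale N (n + 1))

lemma optimalStep_pos {N : ℝ} (n : ℕ) (h : (n + 1 : ℝ) ≤ N) : 0 < optimalStep N n := by
  have hn : (0 : ℝ) ≤ n := Nat.cast_nonneg n
  have hN : 0 < N := by linarith
  have h0 := gramScale_pos hN n (by linarith)
  have h1 := gramScale_pos hN (n + 1) (by push_cast; linarith)
  have := Real.pi_pos
  unfold optimalStep
  positivity

lemma optimalStep_zero {N : ℝ} (hN : 0 < N) : optimalStep N 0 = 1 / N := by
  have := Real.pi_pos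
  simp only [optimalStep, gramScale]
  push_cast
  field_simp
  ring

/-- The middle normalization factor cancels and the outer two are tied by the recursion, so products
of neighbouring steps are explicit although single steps are not. -/
lemma optimalStep_mul_succ {N : ℝ} (n : ℕ) (h : (n + 2 : ℝ) ≤ N) :
    optimalStep N n * optimalStep N (n + 1) =
      4 * (4 * (n + 1) ^ 2 - 1) / (Real.pi ^ 2 * ((n + 1) ^ 2 * (N ^ 2 - (n + 1) ^ 2))) := by
  have hn : (0 : ℝ) ≤ n := Nat.cast_nonneg n
  have hN : 0 < N := by linarith
  have h0 := (gramScale_pos hN n (by linarith)).ne'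
  have h1 := (gramScale_pos hN (n + 1) (by push_cast; linarith)).ne'
  have h2 : N ^ 2 - (n + 1 : ℝ) ^ 2 ≠ 0 := by nlinarith
  have h3 := Real.pi_pos.ne'
  have h4 : (n + 1 : ℝ) ≠ 0 := by positivity
  have h5 : (n + 2 : ℝ) ≠ 0 := by positivity
  simp only [optimalStep, gramScale]
  push_cast
  rw [show (n : ℝ) + 1 + 1 = n + 2 by ring]
  field_simp
  ring

lemma gram_div_scale_add_two {N : ℝ} (n : ℕ) (h : (n + 2 : ℝ) ≤ N) (x : ℝ) :
    gram N (n + 2) x / gramScale N (n + 2) =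
      Real.pi * x * optimalStep N (n + 1) * (gram N (n + 1) x / gramScale N (n + 1))
        - gram N n x / gramScale N n := by
  have hn : (0 : ℝ) ≤ n := Nat.cast_nonneg n
  have hN : 0 < N := by linarith
  have h0 := (gramScale_pos hN n (by linarith)).ne'
  have h1 := (gramScale_pos hN (n + 1) (by push_cast; linarith)).ne'
  have h2 : N ^ 2 - (n + 1 : ℝ) ^ 2 ≠ 0 := by nlinarith
  have h3 := Real.pi_pos.ne'
  have h4 : (n + 1 : ℝ) ≠ 0 := by positivity
  have h5 : (n + 2 : ℝ) ≠ 0 := by positivity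
  simp only [optimalStep, gramScale, gram]
  push_cast
  rw [show (n : ℝ) + 1 + 1 = n + 2 by ring]
  field_simp
  ring

/-- The values of the normalized Gram polynomials on the primary grid. -/
def gramPrim (N x : ℝ) (i : ℕ) : ℝ := (-1) ^ i * (gram N (2 * i) x / gramScale N (2 * i))

/-- The fluxes of the normalized Gram polynomials. -/
def gramFlux (N x : ℝ) : ℕ → ℝ
  | 0 => 0
  | i + 1 => Real.pi * x * (-1) ^ (i + 1) * (gram N (2 * i + 1) x / gramScale N (2 * i + 1))

/-- The coefficients of the optimal grid. -/
def gramCoeffs (ℓ : ℕ) : Coeffs ℓ where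
  prim i := optimalStep (2 * ℓ) (2 * i + 1)
  dual i := optimalStep (2 * ℓ) (2 * i)

lemma gramCoeffs_prim_pos {ℓ : ℕ} (i : Fin ℓ) : 0 < (gramCoeffs ℓ).prim i := by
  apply optimalStep_pos
  have := i.2
  exact_mod_cast (by omega : 2 * i.val + 1 + 1 ≤ 2 * ℓ)

lemma gramCoeffs_dual_pos {ℓ : ℕ} (i : Fin ℓ) : 0 < (gramCoeffs ℓ).dual i := by
  apply optimalStep_pos
  have := i.2
  exact_mod_cast (by omega : 2 * i.val + 1 ≤ 2 * ℓ)

/-- Even degrees carry the values and odd degrees the fluxes; with alternating signs the recurrence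
splits into the two staggered equations. -/
lemma isStaggeredSolution_gram (ℓ : ℕ) (x : ℝ) :
    IsStaggeredSolution (gramCoeffs ℓ) (-(Real.pi * x) ^ 2)
      (gramPrim (2 * ℓ) x) (gramFlux (2 * ℓ) x) where
  flux_zero := rfl
  prim_eq i := by
    have hi : ((2 * i.val : ℕ) + 2 : ℝ) ≤ 2 * ℓ := by
      exact_mod_cast (by omega : 2 * i.val + 2 ≤ 2 * ℓ)
    have h := gram_div_scale_add_two (2 * i.val) hi x
    simp only [gramPrim, gramFlux, gramCoeffs]
    rw [show 2 * (i.val + 1) = 2 * i.val + 2 by ring, h]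
    ring
  dual_eq i := by
    obtain ⟨i, hi⟩ := i
    have hℓ : (0 : ℝ) < 2 * ℓ := by
      have : (0 : ℝ) < ℓ := by exact_mod_cast (by omega : 0 < ℓ)
      linarith
    cases i with
    | zero =>
      have := Real.pi_pos
      simp only [gramPrim, gramFlux, gramCoeffs, mul_zero, optimalStep_zero hℓ]
      simp only [gram, gramScale]
      field_simp
      ring
    | succ i =>
      have hi : ((2 * i + 1 : ℕ) + 2 : ℝ) ≤ 2 * ℓ := by
        exact_mod_cast (by omega : 2 * i + 1 + 2 ≤ 2 * ℓ)
      have h := gram_div_scale_add_two (2 * i + 1) hi x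
      simp only [gramPrim, gramFlux, gramCoeffs]
      rw [show 2 * (i + 1) + 1 = 2 * i + 1 + 2 by ring, h,
        show 2 * (i + 1) = 2 * i + 1 + 1 by ring]
      ring

lemma gramPrim_zero (N x : ℝ) : gramPrim N x 0 = 1 := by simp [gramPrim, gram, gramScale]

lemma gramPrim_node_last (ℓ j : ℕ) (hj : j < ℓ) : gramPrim (2 * ℓ) (j + 1 / 2) ℓ = 0 := by
  have h := gram_node_eq_zero (2 * ℓ) (ℓ + j) (by omega)
  push_cast at h
  unfold gramPrim
  rw [show (j : ℝ) + 1 / 2 = -(2 * ℓ) / 2 + 1 / 2 + (ℓ + j) by ring, h]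
  simp

lemma gramPrim_half_pos {ℓ : ℕ} : ∀ i : ℕ, i < ℓ → 0 < gramPrim (2 * ℓ) (1 / 2) i
  | 0, _ => by simp [gramPrim_zero]
  | i + 1, hi => by
    have h := gramPrim_half_pos (ℓ := ℓ) i (by omega)
    have hi' : (i : ℝ) + 2 ≤ ℓ := by exact_mod_cast hi
    have hi0 : (0 : ℝ) ≤ i := Nat.cast_nonneg i
    have h1 : 0 < (2 * ℓ : ℝ) ^ 2 - (2 * i + 1) ^ 2 := by nlinarith
    have h2 : 0 < (2 * ℓ : ℝ) ^ 2 - (2 * i + 2) ^ 2 := by nlinarith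
    have hs : gramScale (2 * ℓ) (2 * (i + 1)) = gramScale (2 * ℓ) (2 * i) *
        ((2 * i + 1) * ((2 * ℓ : ℝ) ^ 2 - (2 * i + 1) ^ 2) / (2 * i + 2)) := by
      rw [show 2 * (i + 1) = 2 * i + 2 by ring, gramScale]
      push_cast
      rfl
    have h0 : gramScale (2 * ℓ) (2 * i) ≠ 0 :=
      (gramScale_pos (by linarith) _ (by push_cast; linarith)).ne'
    have heq : gramPrim (2 * ℓ) (1 / 2) (i + 1) =
        ((2 * ℓ : ℝ) ^ 2 - (2 * i + 2) ^ 2) / ((2 * ℓ : ℝ) ^ 2 - (2 * i + 1) ^ 2)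
          * gramPrim (2 * ℓ) (1 / 2) i := by
      unfold gramPrim
      rw [gram_even_half (2 * ℓ) i h1.ne', hs]
      have h3 : (2 * i + 2 : ℝ) ≠ 0 := by positivity
      have h4 : (2 * i + 1 : ℝ) ≠ 0 := by positivity
      have h5 := h1.ne'
      field_simp
      ring
    rw [heq]
    exact mul_pos (div_pos h2 h1) h

lemma specData_zero_delta_sq (j : ℕ) : (specData 0).δ j ^ 2 = (Real.pi * (j + 1 / 2)) ^ 2 := by
  rw [specData_delta_sq neg_pi_sq_div_four_neg]
  simp [freq]

lemma IsSpectralData.injective_eigenvalue {σ : ℝ → ℝ} {D : SpectralData}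
    (h : IsSpectralData σ D) : Function.Injective fun j => -(D.δ j) ^ 2 := by
  intro i j hij
  simp only [neg_inj] at hij
  exact h.strictMono.injective ((sq_eq_sq₀ (h.pos i).le (h.pos j).le).1 hij)

/-- By orthogonality, the norm of eigenvector `k` equals its inner product with the sum of all
eigenvectors. That sum vanishes off the first node by `sum_gram_even`, leaving `ℓ / (2 * ℓ)`. -/
lemma sum_dual_mul_gramPrim_sq {ℓ : ℕ} (k : Fin ℓ) :
    ∑ p : Fin ℓ, (gramCoeffs ℓ).dual p * gramPrim (2 * ℓ) (k + 1 / 2) p ^ 2 = 1 / 2 := by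
  have hℓ : (0 : ℝ) < ℓ := by exact_mod_cast (by have := k.2; omega : 0 < ℓ)
  have horth : ∀ j : Fin ℓ, j ≠ k → ∑ p : Fin ℓ, (gramCoeffs ℓ).dual p *
      gramPrim (2 * ℓ) (k + 1 / 2) p * gramPrim (2 * ℓ) (j + 1 / 2) p = 0 := by
    intro j hj
    refine (isStaggeredSolution_gram ℓ (k + 1 / 2)).orthogonal
      (isStaggeredSolution_gram ℓ (j + 1 / 2)) (gramPrim_node_last ℓ k k.2)
      (gramPrim_node_last ℓ j j.2) ?_
    intro h
    apply hj
    have hpi := Real.pi_pos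
    have h1 : Real.pi * ((k : ℕ) + 1 / 2 : ℝ) = Real.pi * ((j : ℕ) + 1 / 2 : ℝ) :=
      (sq_eq_sq₀ (by positivity) (by positivity)).1 (neg_inj.1 h)
    have h2 := mul_left_cancel₀ hpi.ne' h1
    have h3 : ((j : ℕ) : ℝ) = (k : ℕ) := by linarith
    exact Fin.ext (by exact_mod_cast h3)
  have hsum : ∀ p : Fin ℓ, (gramCoeffs ℓ).dual p *
      ∑ j : Fin ℓ, gramPrim (2 * ℓ) (j + 1 / 2) p = if p.val = 0 then 1 / 2 else 0 := by
    intro p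
    rw [Fin.sum_univ_eq_sum_range (fun j => gramPrim (2 * ℓ) (j + 1 / 2) p) ℓ]
    obtain ⟨p, hp⟩ := p
    cases p with
    | zero =>
      simp only [gramPrim_zero, gramCoeffs, mul_zero, if_true]
      rw [optimalStep_zero (by linarith)]
      simp
      field_simp
    | succ p =>
      simp only [gramPrim]
      rw [← Finset.mul_sum, ← Finset.sum_div, sum_gram_even]
      simp
  calc ∑ p : Fin ℓ, (gramCoeffs ℓ).dual p * gramPrim (2 * ℓ) (k + 1 / 2) p ^ 2
      = ∑ j : Fin ℓ, ∑ p : Fin ℓ, (gramCoeffs ℓ).dual p *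
          gramPrim (2 * ℓ) (k + 1 / 2) p * gramPrim (2 * ℓ) (j + 1 / 2) p := by
        rw [Finset.sum_eq_single k (fun j _ hj => horth j hj) (by simp)]
        exact Finset.sum_congr rfl fun p _ => by ring
    _ = ∑ p : Fin ℓ, gramPrim (2 * ℓ) (k + 1 / 2) p * ((gramCoeffs ℓ).dual p *
          ∑ j : Fin ℓ, gramPrim (2 * ℓ) (j + 1 / 2) p) := by
        rw [Finset.sum_comm]
        refine Finset.sum_congr rfl fun p _ => ?_
        rw [← Finset.mul_sum]
        ring
    _ = 1 / 2 := by
        simp only [hsum, mul_ite, mul_zero]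
        rw [sum_ite_val_eq (fun p : Fin ℓ => gramPrim (2 * ℓ) (k + 1 / 2) p * (1 / 2))
          (n := 0) (by have := k.2; omega), gramPrim_zero]
        ring

theorem solvesInverse_gramCoeffs (ℓ : ℕ) : SolvesInverse (specData 0) (gramCoeffs ℓ) where
  prim_pos := gramCoeffs_prim_pos
  dual_pos := gramCoeffs_dual_pos
  spectrum j := by
    have hs := (isStaggeredSolution_gram ℓ (j + 1 / 2)).const_mul (Real.sqrt 2)
    refine ⟨fun p => Real.sqrt 2 * gramPrim (2 * ℓ) (j + 1 / 2) p, ?_, ?_, ?_⟩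
    · rw [specData_zero_delta_sq]
      exact hs.mulVec gramCoeffs_prim_pos gramCoeffs_dual_pos
        (by rw [gramPrim_node_last ℓ j j.2, mul_zero])
    · simp only [mul_pow, Real.sq_sqrt zero_le_two]
      simp only [mul_left_comm _ (2 : ℝ)]
      rw [← Finset.mul_sum, sum_dual_mul_gramPrim_sq]
      norm_num
    · intro p hp
      simp only [hp, gramPrim_zero, mul_pow, Real.sq_sqrt zero_le_two]
      simp [specData]

/-! ### Monotonicity and decay of the steps. -/

/-- The limit, as `N → ∞`, of the product of two consecutive ratios of steps. -/
def stepRatioProd (n : ℕ) : ℝ := 1 + 1 / ((n + 2 : ℝ) ^ 2 * (2 * n + 1))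

/-- The limit, as `N → ∞`, of the ratio of the steps with indices `n + 1` and `n`. -/
def stepRatio : ℕ → ℝ
  | 0 => 12 / Real.pi ^ 2
  | n + 1 => stepRatioProd n / stepRatio n

lemma stepRatioProd_pos (n : ℕ) : 0 < stepRatioProd n := by
  unfold stepRatioProd; positivity

lemma stepRatioProd_antitone (n : ℕ) : stepRatioProd (n + 1) ≤ stepRatioProd n := by
  unfold stepRatioProd
  push_cast
  gcongr <;> linarith

lemma stepRatio_pos : ∀ n, 0 < stepRatio n
  | 0 => by have := Real.pi_pos; unfold stepRatio; positivity
  | n + 1 => div_pos (stepRatioProd_pos n) (stepRatio_pos n)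

lemma stepRatio_mul_succ (n : ℕ) : stepRatio n * stepRatio (n + 1) = stepRatioProd n := by
  have := (stepRatio_pos n).ne'
  rw [stepRatio]
  field_simp

lemma stepRatio_add_two_le (n : ℕ) : stepRatio (n + 2) ≤ stepRatio n := by
  have h1 := stepRatio_mul_succ n
  have h2 := stepRatio_mul_succ (n + 1)
  have h3 := stepRatioProd_antitone n
  have h4 := stepRatio_pos (n + 1)
  rw [← h1, ← h2, mul_comm (stepRatio n)] at h3
  exact le_of_mul_le_mul_left h3 h4

/-- The quotient of two consecutive values of `stepRatioProd` contains the squared Wallis factor. -/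
lemma stepRatio_even (i : ℕ) :
    stepRatio (2 * i) = 4 * (4 * i + 3) / (Real.pi ^ 2 * (4 * i + 1)) * Real.Wallis.W i ^ 2 := by
  have hpi := Real.pi_pos.ne'
  induction i with
  | zero =>
    simp [stepRatio, Real.Wallis.W]
    norm_num
  | succ i ih =>
    have h1 := stepRatio_mul_succ (2 * i)
    have h2 := stepRatio_mul_succ (2 * i + 1)
    have h3 := (stepRatio_pos (2 * i + 1)).ne'
    have h4 := (stepRatioProd_pos (2 * i)).ne'
    have h5 : stepRatio (2 * i + 1 + 1)
        = stepRatioProd (2 * i + 1) / stepRatioProd (2 * i) * stepRatio (2 * i) := by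
      rw [← h1, ← h2]
      have := (stepRatio_pos (2 * i)).ne'
      field_simp
    have h6 : stepRatioProd (2 * i + 1) / stepRatioProd (2 * i) =
        (4 * i + 7) * (4 * i + 1) * (2 * i + 2) ^ 4 /
          ((4 * i + 3) * (4 * i + 5) * ((2 * i + 1) * (2 * i + 3)) ^ 2) := by
      have e1 : stepRatioProd (2 * i) = (2 * i + 1) ^ 2 * (4 * i + 5) /
          ((2 * i + 2) ^ 2 * (4 * i + 1)) := by
        unfold stepRatioProd
        push_cast
        field_simp
        ring
      have e2 : stepRatioProd (2 * i + 1) = (2 * i + 2) ^ 2 * (4 * i + 7) /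
          ((2 * i + 3) ^ 2 * (4 * i + 3)) := by
        unfold stepRatioProd
        push_cast
        rw [show (2 * i + 1 + 2 : ℝ) = 2 * i + 3 by ring,
          show (2 * (2 * i + 1) + 1 : ℝ) = 4 * i + 3 by ring]
        field_simp
        ring
      rw [e1, e2]
      field_simp
    rw [show 2 * (i + 1) = 2 * i + 1 + 1 by ring, h5, h6, ih, Real.Wallis.W_succ]
    push_cast
    rw [show (4 * (i + 1 : ℝ) + 3) = 4 * i + 7 by ring,
      show (4 * (i + 1 : ℝ) + 1) = 4 * i + 5 by ring]
    field_simp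

lemma tendsto_ratio_affine (a b : ℝ) :
    Tendsto (fun i : ℕ => (4 * (i : ℝ) + a) / (4 * i + b)) atTop (𝓝 1) := by
  have h := tendsto_natCast_atTop_atTop (R := ℝ)
  have h1 : Tendsto (fun i : ℕ => 1 + (a - b) / (4 * (i : ℝ) + b)) atTop (𝓝 (1 + 0)) :=
    tendsto_const_nhds.add (tendsto_const_nhds.div_atTop
      (tendsto_atTop_add_const_right _ _ (h.const_mul_atTop (by norm_num))))
  rw [add_zero] at h1
  refine h1.congr' ?_
  filter_upwards [(tendsto_atTop_add_const_right _ b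
    (h.const_mul_atTop (by norm_num : (0 : ℝ) < 4))).eventually_gt_atTop 0] with i hi
  have := hi.ne'
  field_simp
  ring

lemma tendsto_stepRatio_even : Tendsto (fun i => stepRatio (2 * i)) atTop (𝓝 1) := by
  have hpi := Real.pi_pos.ne'
  have h := ((tendsto_ratio_affine 3 1).mul (Real.tendsto_prod_pi_div_two.pow 2)).const_mul
    (4 / Real.pi ^ 2)
  rw [show 4 / Real.pi ^ 2 * (1 * (Real.pi / 2) ^ 2) = 1 by field_simp; norm_num] at h
  refine h.congr fun i => ?_
  rw [stepRatio_even]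
  unfold Real.Wallis.W
  field_simp

lemma tendsto_stepRatio_odd : Tendsto (fun i => stepRatio (2 * i + 1)) atTop (𝓝 1) := by
  have hP : Tendsto (fun i : ℕ => stepRatioProd (2 * i)) atTop (𝓝 1) := by
    have h : Tendsto (fun n : ℕ => 1 / ((n : ℝ) + 1)) atTop (𝓝 0) :=
      tendsto_one_div_add_atTop_nhds_zero_nat
    refine tendsto_of_tendsto_of_tendsto_of_le_of_le tendsto_const_nhds
      (by simpa using h.const_add 1) (fun i => ?_) fun i => ?_
    · unfold stepRatioProd
      have : 0 < 1 / (((2 * i : ℕ) + 2 : ℝ) ^ 2 * (2 * (2 * i : ℕ) + 1)) := by positivity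
      linarith
    · unfold stepRatioProd
      have hi : (0 : ℝ) ≤ i := Nat.cast_nonneg i
      have h1 : 1 / (((2 * i : ℕ) + 2 : ℝ) ^ 2 * (2 * (2 * i : ℕ) + 1)) ≤ 1 / ((i : ℝ) + 1) := by
        push_cast
        exact one_div_le_one_div_of_le (by positivity)
          (by nlinarith [mul_nonneg hi hi, mul_nonneg (mul_nonneg hi hi) hi])
      simpa using h1
  have h := hP.div tendsto_stepRatio_even one_ne_zero
  rw [div_one] at h
  exact h

/-- Both parity subsequences decrease, and Wallis' product identifies their limit as `1`. -/
lemma one_le_stepRatio (n : ℕ) : 1 ≤ stepRatio n := by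
  rcases Nat.even_or_odd' n with ⟨i, rfl | rfl⟩
  · exact (antitone_nat_of_succ_le fun i => stepRatio_add_two_le (2 * i)).le_of_tendsto
      tendsto_stepRatio_even i
  · exact (antitone_nat_of_succ_le (f := fun i => stepRatio (2 * i + 1))
      fun i => stepRatio_add_two_le (2 * i + 1)).le_of_tendsto tendsto_stepRatio_odd i

/-- The effect of a finite `N` on the ratios of steps. -/
def stepRatioFactor (N : ℝ) : ℕ → ℝ
  | 0 => N ^ 2 / (N ^ 2 - 1)
  | n + 1 => (N ^ 2 - (n + 1) ^ 2) / (N ^ 2 - (n + 2) ^ 2) / stepRatioFactor N n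

/-- The quotients `(N ^ 2 - (n + 1) ^ 2) / (N ^ 2 - (n + 2) ^ 2)` increase with `n`, so the factor
does not decrease over two indices; hence the two base cases. -/
lemma one_le_stepRatioFactor {N : ℝ} : ∀ n : ℕ, (n + 2 : ℝ) ≤ N → 1 ≤ stepRatioFactor N n
  | 0, h => by
    have : (0 : ℝ) < N ^ 2 - 1 := by norm_num at h; nlinarith
    rw [stepRatioFactor, one_le_div this]
    linarith
  | 1, h => by
    have h1 : (0 : ℝ) < N ^ 2 - 1 := by norm_num at h; nlinarith
    have h2 : (0 : ℝ) < N ^ 2 - 4 := by norm_num at h; nlinarith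
    have h3 : 0 < N := by norm_num at h; linarith
    simp only [stepRatioFactor]
    norm_num
    rw [div_div_div_eq, one_le_div (by positivity)]
    nlinarith
  | n + 2, h => by
    push_cast at h
    have hn : (0 : ℝ) ≤ n := Nat.cast_nonneg n
    have ih := one_le_stepRatioFactor (N := N) n (by linarith)
    have h1 : (0 : ℝ) < N ^ 2 - (n + 1) ^ 2 := by nlinarith
    have h2 : (0 : ℝ) < N ^ 2 - (n + 2) ^ 2 := by nlinarith
    have h3 : (0 : ℝ) < N ^ 2 - (n + 3) ^ 2 := by nlinarith
    simp only [stepRatioFactor]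
    push_cast
    rw [show (n + 1 + 1 : ℝ) = n + 2 by ring, show (n + 1 + 2 : ℝ) = n + 3 by ring]
    have h4 : 1 ≤ (N ^ 2 - (n + 2 : ℝ) ^ 2) / (N ^ 2 - (n + 3) ^ 2)
        / ((N ^ 2 - (n + 1) ^ 2) / (N ^ 2 - (n + 2) ^ 2)) := by
      rw [div_div_div_eq, one_le_div (mul_pos h3 h1)]
      nlinarith [sq_nonneg N]
    calc (1 : ℝ) = 1 * 1 := by ring
      _ ≤ _ := mul_le_mul h4 ih zero_le_one (zero_le_one.trans h4)
      _ = _ := by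
        have := (zero_lt_one.trans_le ih).ne'
        field_simp

lemma optimalStep_succ_eq {N : ℝ} (hN : 0 < N) : ∀ n : ℕ, (n + 2 : ℝ) ≤ N →
    optimalStep N (n + 1) = stepRatio n * stepRatioFactor N n * optimalStep N n
  | 0, h => by
    have h1 : (0 : ℝ) < N ^ 2 - 1 := by norm_num at h; nlinarith
    have h2 := optimalStep_mul_succ (N := N) 0 h
    have hpi := Real.pi_pos
    rw [optimalStep_zero hN] at h2 ⊢
    simp only [stepRatio, stepRatioFactor]
    have h3 : optimalStep N (0 + 1) = N * (1 / N * optimalStep N (0 + 1)) := by field_simp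
    rw [h3, h2]
    norm_num
    have h4 := h1.ne'
    field_simp
  | n + 1, h => by
    push_cast at h
    have hn : (0 : ℝ) ≤ n := Nat.cast_nonneg n
    have ih := optimalStep_succ_eq hN n (by linarith)
    have h1 : (0 : ℝ) < N ^ 2 - (n + 1) ^ 2 := by nlinarith
    have h2 : (0 : ℝ) < N ^ 2 - (n + 2) ^ 2 := by nlinarith
    have e1 := optimalStep_mul_succ (N := N) n (by linarith)
    have e2 := optimalStep_mul_succ (N := N) (n + 1) (by push_cast; linarith)
    have p0 := optimalStep_pos (N := N) n (by linarith)
    have p1 := optimalStep_pos (N := N) (n + 1) (by push_cast; linarith)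
    have hf : 0 < stepRatioFactor N n :=
      zero_lt_one.trans_le (one_le_stepRatioFactor n (by linarith))
    have hr := stepRatio_pos n
    have hpi := Real.pi_pos
    have hkey : optimalStep N (n + 1) * optimalStep N (n + 1 + 1) =
        stepRatioProd n * ((N ^ 2 - (n + 1) ^ 2) / (N ^ 2 - (n + 2) ^ 2)) *
          (optimalStep N n * optimalStep N (n + 1)) := by
      rw [e1, e2]
      unfold stepRatioProd
      push_cast
      have h1' := h1.ne'
      have h2' : (N ^ 2 - (n + 1 + 1 : ℝ) ^ 2) ≠ 0 := by
        rw [show (n + 1 + 1 : ℝ) = n + 2 by ring]; exact h2.ne'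
      rw [show (n + 2 : ℝ) = n + 1 + 1 by ring]
      field_simp
      ring
    apply mul_left_cancel₀ p1.ne'
    rw [hkey]
    simp only [stepRatio, stepRatioFactor]
    nth_rewrite 3 [ih]
    field_simp

lemma optimalStep_le_succ {N : ℝ} (n : ℕ) (h : (n + 2 : ℝ) ≤ N) :
    optimalStep N n ≤ optimalStep N (n + 1) := by
  have hn : (0 : ℝ) ≤ n := Nat.cast_nonneg n
  rw [optimalStep_succ_eq (by linarith) n h]
  refine le_mul_of_one_le_left (optimalStep_pos n (by linarith)).le ?_
  exact one_le_mul_of_one_le_of_one_le (one_le_stepRatio n) (one_le_stepRatioFactor n h)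

lemma optimalStep_mono {N m n : ℕ} (hmn : m ≤ n) (hn : n + 1 ≤ N) :
    optimalStep N m ≤ optimalStep N n := by
  induction n, hmn using Nat.le_induction with
  | base => exact le_rfl
  | succ n _ ih =>
    exact (ih (by omega)).trans (optimalStep_le_succ n (by exact_mod_cast hn))

/-- The largest step is of order `N^(-1/2)`. -/
lemma optimalStep_last_sq_le (n : ℕ) :
    optimalStep (n + 3 : ℕ) (n + 2) ^ 2 ≤ 16 / (n + 1) := by
  have hn : (0 : ℝ) ≤ n := Nat.cast_nonneg n
  have e1 := optimalStep_mul_succ (N := (n + 3 : ℕ)) n (by push_cast; linarith)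
  have e2 := optimalStep_mul_succ (N := (n + 3 : ℕ)) (n + 1) (by push_cast; linarith)
  have p0 := optimalStep_pos (N := (n + 3 : ℕ)) n (by push_cast; linarith)
  have p1 := optimalStep_pos (N := (n + 3 : ℕ)) (n + 1) (by push_cast; linarith)
  have p2 := optimalStep_pos (N := (n + 3 : ℕ)) (n + 2) (by push_cast; linarith)
  have m := optimalStep_le_succ (N := (n + 3 : ℕ)) n (by push_cast; linarith)
  have hpi := Real.pi_gt_three
  push_cast at e1 e2
  rw [show (n + 1 + 1 : ℕ) = n + 2 from rfl] at e2
  push_cast at p0 p1 p2 m ⊢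
  rw [show ((n : ℝ) + 3) ^ 2 - (n + 1) ^ 2 = 4 * (n + 2) by ring] at e1
  rw [show ((n : ℝ) + 3) ^ 2 - (n + 1 + 1) ^ 2 = 2 * n + 5 by ring] at e2
  set a := optimalStep (n + 3) n
  set b := optimalStep (n + 3) (n + 1)
  set c := optimalStep (n + 3) (n + 2)
  -- Only the products `a * b` and `b * c` are explicit. Monotonicity `a ≤ b` turns the first into a
  -- lower bound for `b ^ 2`, which with the second bounds `c`.
  have hb : 3 / (Real.pi ^ 2 * (n + 2)) ≤ b ^ 2 := by
    calc 3 / (Real.pi ^ 2 * (n + 2)) ≤ a * b := by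
          rw [e1, div_le_div_iff₀ (by positivity) (by positivity)]
          have : 0 ≤ Real.pi ^ 2 * (n + 2 : ℝ) := by positivity
          nlinarith [mul_nonneg this (mul_nonneg hn hn), mul_nonneg this hn]
      _ ≤ b ^ 2 := by nlinarith
  have hbc : b * c ≤ 16 / (Real.pi ^ 2 * (2 * n + 5)) := by
    rw [e2, div_le_div_iff₀ (by positivity) (by positivity)]
    have : 0 ≤ Real.pi ^ 2 * (2 * n + 5 : ℝ) := by positivity
    nlinarith
  have hbc2 : b ^ 2 * c ^ 2 ≤ (16 / (Real.pi ^ 2 * (2 * n + 5))) ^ 2 := by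
    rw [← mul_pow]
    exact pow_le_pow_left₀ (by positivity) hbc 2
  have hb3 : 3 / (Real.pi ^ 2 * (n + 2)) * c ^ 2 ≤ (16 / (Real.pi ^ 2 * (2 * n + 5))) ^ 2 :=
    (mul_le_mul_of_nonneg_right hb (by positivity)).trans hbc2
  have hc : c ^ 2 ≤ (16 / (Real.pi ^ 2 * (2 * n + 5))) ^ 2 * (Real.pi ^ 2 * (n + 2) / 3) := by
    calc c ^ 2 = 3 / (Real.pi ^ 2 * (n + 2)) * c ^ 2 * (Real.pi ^ 2 * (n + 2) / 3) := by
          field_simp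
      _ ≤ _ := mul_le_mul_of_nonneg_right hb3 (by positivity)
  refine hc.trans ?_
  have hpi2 : 9 ≤ Real.pi ^ 2 := by nlinarith
  calc (16 / (Real.pi ^ 2 * (2 * n + 5))) ^ 2 * (Real.pi ^ 2 * (n + 2 : ℝ) / 3)
      = 256 * (n + 2 : ℝ) / (Real.pi ^ 2 * (3 * (2 * n + 5) ^ 2)) := by
        field_simp
        norm_num
    _ ≤ 256 * (n + 2 : ℝ) / (9 * (3 * (2 * n + 5) ^ 2)) := by gcongr
    _ ≤ 16 / (n + 1 : ℝ) := by
        rw [div_le_div_iff₀ (by positivity) (by positivity)]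
        nlinarith [mul_nonneg hn hn]

lemma tendsto_optimalStep_last :
    Tendsto (fun ℓ : ℕ => optimalStep (2 * ℓ) (2 * ℓ - 1)) atTop (𝓝 0) := by
  have h : Tendsto (fun ℓ : ℕ => Real.sqrt (16 / ((2 * ℓ - 3 : ℕ) + 1))) atTop (𝓝 0) := by
    have h1 : Tendsto (fun ℓ : ℕ => 2 * ℓ - 3) atTop atTop :=
      tendsto_atTop_mono (fun ℓ => by omega : ∀ ℓ : ℕ, ℓ - 3 ≤ 2 * ℓ - 3)
        (tendsto_sub_atTop_nat 3)
    have h2 := ((tendsto_one_div_add_atTop_nhds_zero_nat (𝕜 := ℝ)).comp h1).const_mul 16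
    have h3 := (Real.continuous_sqrt.tendsto _).comp h2
    simp only [mul_zero, Real.sqrt_zero] at h3
    refine h3.congr fun ℓ => ?_
    simp only [Function.comp]
    congr 1
    ring
  refine tendsto_of_tendsto_of_tendsto_of_le_of_le' tendsto_const_nhds h ?_ ?_
  all_goals
    filter_upwards [eventually_ge_atTop 2] with ℓ hℓ
    obtain ⟨n, hn⟩ : ∃ n, 2 * ℓ = n + 3 := ⟨2 * ℓ - 3, by omega⟩
    have hc : (2 * ℓ : ℝ) = (n + 3 : ℕ) := by rw [← hn]; push_cast; ring
    rw [hn, hc, show n + 3 - 1 = n + 2 by omega]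
  · exact (optimalStep_pos _ (by push_cast; linarith)).le
  · rw [show n + 3 - 3 = n by omega]
    exact Real.le_sqrt_of_sq_le (optimalStep_last_sq_le n)

/-! ### The discrete Liouville transform. -/

/-- The discrete analogue of `genCos q` and of its derivative on the optimal grid. -/
def gridCos (q N : ℝ) : ℕ → ℝ × ℝ
  | 0 => (1, 0)
  | n + 1 =>
    ((gridCos q N n).1 + optimalStep N (2 * n + 1) *
        ((gridCos q N n).2 + q * optimalStep N (2 * n) * (gridCos q N n).1),
      (gridCos q N n).2 + q * optimalStep N (2 * n) * (gridCos q N n).1)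

lemma isStaggeredSolution_gridCos (q : ℝ) (ℓ : ℕ) :
    IsStaggeredSolution (gramCoeffs ℓ) q (fun n => (gridCos q (2 * ℓ) n).1)
      (fun n => (gridCos q (2 * ℓ) n).2) where
  flux_zero := rfl
  prim_eq i := by simp only [gridCos, gramCoeffs]; ring
  dual_eq i := by simp only [gridCos, gramCoeffs]; ring

/-- Sturm comparison with the first eigenvector. -/
lemma gridCos_pos {q : ℝ} (hq : -(Real.pi ^ 2 / 4) < q) {ℓ : ℕ} {n : ℕ} (hn : n ≤ ℓ) :
    0 < (gridCos q (2 * ℓ) n).1 := by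
  have hS := isStaggeredSolution_gridCos q ℓ
  have hΦ := isStaggeredSolution_gram ℓ (1 / 2)
  set S : ℕ → ℝ := fun n => (gridCos q (2 * ℓ) n).1 with hSdef
  set V : ℕ → ℝ := fun n => (gridCos q (2 * ℓ) n).2
  set Φ := gramPrim (2 * ℓ) (1 / 2)
  set Ψ := gramFlux (2 * ℓ) (1 / 2)
  have hΦ0 : ∀ n ≤ ℓ, 0 ≤ Φ n := by
    intro n hn
    rcases hn.lt_or_eq with h | rfl
    · exact (gramPrim_half_pos n h).le
    · rcases Nat.eq_zero_or_pos n with rfl | h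
      · simp [Φ, gramPrim_zero]
      · have := gramPrim_node_last n 0 h
        rw [Nat.cast_zero, zero_add] at this
        exact this.ge
  -- As `q` exceeds the eigenvalue `-(π / 2) ^ 2` of `Φ`, the Wronskian grows while `S` and `Φ` are
  -- positive; its positivity gives `S (n + 1) * Φ n > S n * Φ (n + 1) ≥ 0`.
  have key : 0 < S n ∧ 0 ≤ V n * Φ n - Ψ n * S n := by
    induction n with
    | zero => exact ⟨zero_lt_one, by simp [hS.flux_zero, hΦ.flux_zero]⟩
    | succ n ih =>
      obtain ⟨ih1, ih2⟩ := ih (by omega)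
      have hw := hS.wronskian_step hΦ ⟨n, hn⟩
      have h1 := hS.prim_eq ⟨n, hn⟩
      have h2 := hΦ.prim_eq ⟨n, hn⟩
      have hp := gramCoeffs_prim_pos (⟨n, hn⟩ : Fin ℓ)
      have hd := gramCoeffs_dual_pos (⟨n, hn⟩ : Fin ℓ)
      simp only at hw h1 h2
      have hΦn : 0 < Φ n := gramPrim_half_pos n hn
      have hqp : 0 < q - -(Real.pi * (1 / 2)) ^ 2 := by
        have : (Real.pi * (1 / 2)) ^ 2 = Real.pi ^ 2 / 4 := by ring
        linarith
      have hpos := mul_pos hqp (mul_pos (mul_pos hd ih1) hΦn)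
      have hD : 0 < V (n + 1) * Φ (n + 1) - Ψ (n + 1) * S (n + 1) := by linarith
      refine ⟨?_, hD.le⟩
      have hcross : S (n + 1) * Φ n - S n * Φ (n + 1) =
          (gramCoeffs ℓ).prim ⟨n, hn⟩ *
            (V (n + 1) * Φ (n + 1) - Ψ (n + 1) * S (n + 1)) := by
        linear_combination S (n + 1) * h2 - Φ (n + 1) * h1
      have h3 := mul_pos hp hD
      have h4 := mul_nonneg ih1.le (hΦ0 (n + 1) hn)
      have h5 : 0 < S (n + 1) * Φ n := by linarith
      exact (mul_pos_iff_of_pos_right hΦn).1 h5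
  exact key.1

/-- The discrete Liouville transform of the coefficients of the optimal grid. -/
def liouvilleCoeffs (q : ℝ) (ℓ : ℕ) : Coeffs ℓ where
  prim i := (gramCoeffs ℓ).prim i /
    ((gridCos q (2 * ℓ) i).1 * (gridCos q (2 * ℓ) (i + 1)).1)
  dual i := (gramCoeffs ℓ).dual i * (gridCos q (2 * ℓ) i).1 ^ 2

/-- The new flux is the Wronskian of `y` with the grid solution for `q`: the quotient rule gives the
primary equation and the Green identity the dual one. -/
lemma IsStaggeredSolution.liouville {q : ℝ} (hq : -(Real.pi ^ 2 / 4) < q) {ℓ : ℕ} {μ : ℝ}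
    {y w : ℕ → ℝ} (h : IsStaggeredSolution (gramCoeffs ℓ) μ y w) :
    IsStaggeredSolution (liouvilleCoeffs q ℓ) (μ - q)
      (fun n => y n / (gridCos q (2 * ℓ) n).1)
      (fun n => w n * (gridCos q (2 * ℓ) n).1 - (gridCos q (2 * ℓ) n).2 * y n) where
  flux_zero := by simp [h.flux_zero, gridCos]
  prim_eq i := by
    have hS := isStaggeredSolution_gridCos q ℓ
    have h0 := (gridCos_pos hq i.2.le).ne'
    have h1 := (gridCos_pos hq (show i.val + 1 ≤ ℓ from i.2)).ne'
    have e1 := h.prim_eq i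
    have e2 := hS.prim_eq i
    simp only [liouvilleCoeffs]
    field_simp
    linear_combination (gridCos q (2 * ℓ) (i + 1)).1 * e1 - y (i + 1) * e2
  dual_eq i := by
    have h0 := (gridCos_pos hq i.2.le).ne'
    have e := h.wronskian_step (isStaggeredSolution_gridCos q ℓ) i
    simp only [liouvilleCoeffs]
    rw [e]
    field_simp

/-- The factors `S ^ 2` in the weights and `1 / S` in the eigenvectors cancel in the norm, and `S =
1` at the first node keeps `ξ_j = 2`. -/
theorem solvesInverse_liouvilleCoeffs {q : ℝ} (hq : -(Real.pi ^ 2 / 4) < q) (ℓ : ℕ) :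
    SolvesInverse (specData q) (liouvilleCoeffs q ℓ) := by
  have hp : ∀ i, 0 < (liouvilleCoeffs q ℓ).prim i := fun i =>
    div_pos (gramCoeffs_prim_pos i)
      (mul_pos (gridCos_pos hq i.2.le) (gridCos_pos hq (show i.val + 1 ≤ ℓ from i.2)))
  have hd : ∀ i, 0 < (liouvilleCoeffs q ℓ).dual i := fun i =>
    mul_pos (gramCoeffs_dual_pos i) (pow_pos (gridCos_pos hq i.2.le) 2)
  refine ⟨hp, hd, fun j => ?_⟩
  have hs := (((isStaggeredSolution_gram ℓ (j + 1 / 2)).const_mul (Real.sqrt 2)).liouville hq)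
  refine ⟨fun p => Real.sqrt 2 * gramPrim (2 * ℓ) (j + 1 / 2) p / (gridCos q (2 * ℓ) p).1,
    ?_, ?_, ?_⟩
  · rw [specData_delta_sq hq, show -(freq j ^ 2 + q) = -(Real.pi * (j + 1 / 2)) ^ 2 - q by
      unfold freq; ring]
    exact hs.mulVec hp hd (by rw [gramPrim_node_last ℓ j j.2, mul_zero, zero_div])
  · have : ∀ p : Fin ℓ, (liouvilleCoeffs q ℓ).dual p *
        (Real.sqrt 2 * gramPrim (2 * ℓ) (j + 1 / 2) p / (gridCos q (2 * ℓ) p).1) ^ 2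
        = 2 * ((gramCoeffs ℓ).dual p * gramPrim (2 * ℓ) (j + 1 / 2) p ^ 2) := by
      intro p
      have h0 := (gridCos_pos hq p.2.le).ne'
      simp only [liouvilleCoeffs, div_pow, mul_pow, Real.sq_sqrt zero_le_two]
      field_simp
    rw [Finset.sum_congr rfl fun p _ => this p, ← Finset.mul_sum, sum_dual_mul_gramPrim_sq]
    norm_num
  · intro p hp
    simp [hp, gramPrim_zero, gridCos, specData]

/-! ### Position of the nodes: interlacing and total length. -/

section Nodes

lemma sum_ite_lt_succ {ℓ : ℕ} (f : Fin ℓ → ℝ) {k : ℕ} (hk : k < ℓ) :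
    (∑ i : Fin ℓ, if i.val < k + 1 then f i else 0) =
      (∑ i : Fin ℓ, if i.val < k then f i else 0) + f ⟨k, hk⟩ := by
  rw [← sum_ite_val_eq f hk, ← Finset.sum_add_distrib]
  refine Finset.sum_congr rfl fun i _ => ?_
  split_ifs <;> first | omega | simp

lemma primNode_zero {ℓ : ℕ} (c : Coeffs ℓ) : primNode c 0 = 0 := by simp [primNode]

lemma dualNode_zero {ℓ : ℕ} (c : Coeffs ℓ) : dualNode c 0 = 0 := by simp [dualNode]

lemma primNode_succ {ℓ : ℕ} (c : Coeffs ℓ) {k : ℕ} (hk : k < ℓ) :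
    primNode c (k + 1) = primNode c k + c.prim ⟨k, hk⟩ := sum_ite_lt_succ _ hk

lemma dualNode_succ {ℓ : ℕ} (c : Coeffs ℓ) {k : ℕ} (hk : k < ℓ) :
    dualNode c (k + 1) = dualNode c k + c.dual ⟨k, hk⟩ := sum_ite_lt_succ _ hk

lemma primNode_last {ℓ : ℕ} (c : Coeffs ℓ) : primNode c ℓ = ∑ i, c.prim i := by
  simp [primNode]

lemma primNode_mono {ℓ : ℕ} {c : Coeffs ℓ} (hc : ∀ i, 0 < c.prim i) : Monotone (primNode c) := by
  intro a b hab
  refine Finset.sum_le_sum fun i _ => ?_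
  have := (hc i).le
  split_ifs <;> first | omega | exact this | exact le_rfl

end Nodes

/-- The largest step of the optimal grid. -/
def maxStep (ℓ : ℕ) : ℝ := optimalStep (2 * ℓ) (2 * ℓ - 1)

lemma optimalStep_le_maxStep {ℓ n : ℕ} (hn : n < 2 * ℓ) : optimalStep (2 * ℓ) n ≤ maxStep ℓ := by
  have h := optimalStep_mono (N := 2 * ℓ) (show n ≤ 2 * ℓ - 1 by omega) (by omega)
  push_cast at h
  exact h

lemma maxStep_nonneg {ℓ : ℕ} (hℓ : 0 < ℓ) : 0 ≤ maxStep ℓ :=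
  (gramCoeffs_dual_pos (⟨0, hℓ⟩ : Fin ℓ)).le.trans (optimalStep_le_maxStep (by simpa using hℓ))

lemma gramCoeffs_prim_le {ℓ : ℕ} (i : Fin ℓ) : (gramCoeffs ℓ).prim i ≤ maxStep ℓ :=
  optimalStep_le_maxStep (by have := i.2; omega)

lemma gramCoeffs_dual_le {ℓ : ℕ} (i : Fin ℓ) : (gramCoeffs ℓ).dual i ≤ maxStep ℓ :=
  optimalStep_le_maxStep (by have := i.2; omega)

lemma gramCoeffs_dual_le_prim {ℓ : ℕ} (i : Fin ℓ) : (gramCoeffs ℓ).dual i ≤ (gramCoeffs ℓ).prim i :=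
  optimalStep_le_succ _ (by have := i.2; exact_mod_cast (by omega : 2 * i.val + 2 ≤ 2 * ℓ))

lemma gramCoeffs_prim_le_dual {ℓ : ℕ} {k : ℕ} (hk : k + 1 < ℓ) :
    (gramCoeffs ℓ).prim ⟨k, by omega⟩ ≤ (gramCoeffs ℓ).dual ⟨k + 1, hk⟩ :=
  optimalStep_le_succ (2 * k + 1) (by exact_mod_cast (by omega : 2 * k + 1 + 2 ≤ 2 * ℓ))

/-- The primary and dual nodes of the optimal grid interlace. -/
lemma interlacing {ℓ : ℕ} {k : ℕ} (hk : k < ℓ) :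
    (primNode (gramCoeffs ℓ) k ≤ dualNode (gramCoeffs ℓ) (k + 1) ∧
      dualNode (gramCoeffs ℓ) (k + 1) ≤ primNode (gramCoeffs ℓ) k + (gramCoeffs ℓ).dual ⟨k, hk⟩) ∧
    dualNode (gramCoeffs ℓ) (k + 1) ≤ primNode (gramCoeffs ℓ) (k + 1) ∧
      primNode (gramCoeffs ℓ) (k + 1) ≤
        dualNode (gramCoeffs ℓ) (k + 1) + (gramCoeffs ℓ).prim ⟨k, hk⟩ := by
  induction k with
  | zero =>
    have h1 := gramCoeffs_dual_le_prim (⟨0, hk⟩ : Fin ℓ)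
    have h2 := gramCoeffs_dual_pos (⟨0, hk⟩ : Fin ℓ)
    rw [primNode_succ _ hk, dualNode_succ _ hk, primNode_zero, dualNode_zero]
    refine ⟨⟨?_, ?_⟩, ?_, ?_⟩ <;> linarith
  | succ k ih =>
    have h1 := gramCoeffs_dual_le_prim (⟨k + 1, hk⟩ : Fin ℓ)
    -- The primary node is ahead of the dual one by at most the previous primary step, which the
    -- next dual step covers.
    have h2 := gramCoeffs_prim_le_dual hk
    obtain ⟨-, h3, h4⟩ := ih (by omega)
    rw [primNode_succ _ hk, dualNode_succ _ hk]
    refine ⟨⟨?_, ?_⟩, ?_, ?_⟩ <;> linarith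

lemma dualNode_le_primNode {ℓ : ℕ} {k : ℕ} (hk : k ≤ ℓ) :
    dualNode (gramCoeffs ℓ) k ≤ primNode (gramCoeffs ℓ) k := by
  cases k with
  | zero => rw [primNode_zero, dualNode_zero]
  | succ k => exact (interlacing hk).2.1

lemma dualNode_nonneg {ℓ : ℕ} (k : ℕ) : 0 ≤ dualNode (gramCoeffs ℓ) k :=
  Finset.sum_nonneg fun i _ => by
    split_ifs
    · exact (gramCoeffs_dual_pos i).le
    · exact le_rfl

lemma primNode_nonneg {ℓ : ℕ} (k : ℕ) : 0 ≤ primNode (gramCoeffs ℓ) k := by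
  rw [← primNode_zero (gramCoeffs ℓ)]
  exact primNode_mono gramCoeffs_prim_pos (Nat.zero_le k)

/-- The odd part of `ζ(2)`, equal to `π ^ 2 / 8`. The partial sums are the grid lengths, which
therefore increase to `1`. -/
lemma hasSum_two_div_freq_sq : HasSum (fun j => 2 / freq j ^ 2) 1 := by
  have hz := hasSum_zeta_two
  have hpi := Real.pi_pos
  have heven : HasSum (fun k : ℕ => 1 / ((2 * k : ℕ) : ℝ) ^ 2) (1 / 4 * (Real.pi ^ 2 / 6)) := by
    rw [show (fun k : ℕ => 1 / ((2 * k : ℕ) : ℝ) ^ 2) = fun k : ℕ => 1 / 4 * (1 / (k : ℝ) ^ 2) by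
      funext k
      push_cast
      ring]
    exact hz.mul_left (1 / 4)
  have hodds : Summable (fun k : ℕ => 1 / ((2 * k + 1 : ℕ) : ℝ) ^ 2) :=
    hz.summable.comp_injective (i := fun k : ℕ => 2 * k + 1) fun a b h => by
      have h : 2 * a + 1 = 2 * b + 1 := h
      omega
  have hsum := (HasSum.even_add_odd (f := fun n : ℕ => 1 / (n : ℝ) ^ 2) heven hodds.hasSum).unique hz
  have hodd : HasSum (fun k : ℕ => 1 / ((2 * k + 1 : ℕ) : ℝ) ^ 2) (Real.pi ^ 2 / 8) := by
    convert hodds.hasSum using 1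
    linarith
  have h := hodd.mul_left (8 / Real.pi ^ 2)
  rw [show 8 / Real.pi ^ 2 * (Real.pi ^ 2 / 8) = 1 by field_simp] at h
  rw [show (fun j => 2 / freq j ^ 2)
      = fun j : ℕ => 8 / Real.pi ^ 2 * (1 / ((2 * j + 1 : ℕ) : ℝ) ^ 2) by
    funext j
    unfold freq
    push_cast
    field_simp
    norm_num]
  exact h

lemma primNode_gramCoeffs_last (ℓ : ℕ) :
    primNode (gramCoeffs ℓ) ℓ = ∑ j ∈ Finset.range ℓ, 2 / freq j ^ 2 := by
  have hq := neg_pi_sq_div_four_neg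
  have hD := isSpectralData_specData hq
  rw [primNode_last, (solvesInverse_gramCoeffs ℓ).sum_prim hD.injective_eigenvalue
    fun j => (hD.pos j).ne', ← Fin.sum_univ_eq_sum_range (fun j => 2 / freq j ^ 2)]
  refine Finset.sum_congr rfl fun j _ => ?_
  rw [specData_delta_sq hq, add_zero]
  rfl

lemma primNode_le_one {ℓ : ℕ} {k : ℕ} (hk : k ≤ ℓ) : primNode (gramCoeffs ℓ) k ≤ 1 := by
  refine (primNode_mono gramCoeffs_prim_pos hk).trans ?_
  rw [primNode_gramCoeffs_last]
  exact sum_le_hasSum _ (fun j _ => by positivity) hasSum_two_div_freq_sq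

lemma tendsto_primNode_last :
    Tendsto (fun ℓ => primNode (gramCoeffs ℓ) ℓ) atTop (𝓝 1) := by
  simp only [primNode_gramCoeffs_last]
  exact hasSum_two_div_freq_sq.tendsto_sum_nat

/-! ### Consistency and stability of the discrete solution. -/

section Consistency

lemma abs_sub_le_of_hasDerivAt {f f' : ℝ → ℝ} {M a b : ℝ}
    (hf : ∀ x ∈ Icc a b, HasDerivAt f (f' x) x) (hM : ∀ x ∈ Icc a b, |f' x| ≤ M) {x y : ℝ}
    (hx : x ∈ Icc a b) (hy : y ∈ Icc a b) : |f x - f y| ≤ M * |x - y| := by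
  have := (convex_Icc a b).norm_image_sub_le_of_norm_hasDerivWithin_le
    (fun x hx => (hf x hx).hasDerivWithinAt) (fun x hx => by simpa using hM x hx) hy hx
  simpa using this

/-- The point `c` is arbitrary in the interval, because interlacing is all that is used about the
relative position of the two grids. -/
lemma abs_sub_sub_mul_le {f f' f'' : ℝ → ℝ} {M a b c : ℝ} (ha : 0 ≤ a) (hb : b ≤ 1)
    (hf : ∀ x, HasDerivAt f (f' x) x) (hf' : ∀ x, HasDerivAt f' (f'' x) x)
    (hM : ∀ x ∈ Icc (0 : ℝ) 1, |f'' x| ≤ M) (hc : c ∈ Icc a b) :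
    |f b - f a - (b - a) * f' c| ≤ M * (b - a) * (b - a) := by
  have hab : a ≤ b := hc.1.trans hc.2
  have hsub : Icc a b ⊆ Icc (0 : ℝ) 1 := Icc_subset_Icc ha hb
  have hM0 : 0 ≤ M := (abs_nonneg _).trans (hM c (hsub hc))
  have h := abs_sub_le_of_hasDerivAt (f := fun x => f x - x * f' c) (f' := fun x => f' x - f' c)
    (M := M * (b - a)) (a := a) (b := b)
    (fun x _ => ((hf x).sub ((hasDerivAt_id x).mul_const (f' c))).congr_deriv (by simp))
    (fun x hx => by
      refine (abs_sub_le_of_hasDerivAt (fun x _ => hf' x) (fun x hx => hM x (hsub hx)) hx hc).trans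
        (mul_le_mul_of_nonneg_left ?_ hM0)
      rw [abs_le]
      constructor <;> linarith [hx.1, hx.2, hc.1, hc.2])
    (right_mem_Icc.2 hab) (left_mem_Icc.2 hab)
  rw [abs_of_nonneg (sub_nonneg.2 hab)] at h
  convert h using 2
  ring

end Consistency

lemma exists_bound_genCos (q : ℝ) : ∃ M : ℝ, 0 < M ∧ ∀ x ∈ Icc (0 : ℝ) 1,
    |genCos q x| ≤ M ∧ |genCosDeriv q x| ≤ M ∧ |q * genCos q x| ≤ M := by
  have hc : Continuous (genCos q) :=
    continuous_iff_continuousAt.2 fun x => (hasDerivAt_genCos q x).continuousAt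
  have hd : Continuous (genCosDeriv q) :=
    continuous_iff_continuousAt.2 fun x => (hasDerivAt_genCosDeriv q x).continuousAt
  obtain ⟨A, hA⟩ := isCompact_Icc.exists_bound_of_continuousOn (s := Icc (0 : ℝ) 1)
    hc.continuousOn
  obtain ⟨B, hB⟩ := isCompact_Icc.exists_bound_of_continuousOn (s := Icc (0 : ℝ) 1)
    hd.continuousOn
  have hA0 : 0 ≤ A := (norm_nonneg _).trans (hA 0 (by simp))
  have hB0 : 0 ≤ B := (norm_nonneg _).trans (hB 0 (by simp))
  have hq0 := abs_nonneg q
  refine ⟨A + B + |q| * A + 1, by positivity, fun x hx => ?_⟩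
  have h1 := hA x hx
  have h2 := hB x hx
  rw [Real.norm_eq_abs] at h1 h2
  have h3 := mul_le_mul_of_nonneg_left h1 hq0
  have h4 := mul_nonneg hq0 hA0
  rw [abs_mul]
  refine ⟨?_, ?_, ?_⟩ <;> linarith

/-- A discrete Gronwall estimate. Adding `M * maxStep ℓ` to the errors absorbs the consistency
terms, so that each step multiplies the total by at most `(1 + α) (1 + |q| α̂)`, and these factors
accumulate to the exponential. -/
lemma gridCos_error {q M : ℝ} (hM0 : 0 < M) (hM : ∀ x ∈ Icc (0 : ℝ) 1,
    |genCos q x| ≤ M ∧ |genCosDeriv q x| ≤ M ∧ |q * genCos q x| ≤ M) {ℓ n : ℕ} (hn : n ≤ ℓ) :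
    |(gridCos q (2 * ℓ) n).1 - genCos q (primNode (gramCoeffs ℓ) n)| +
      |(gridCos q (2 * ℓ) n).2 - genCosDeriv q (dualNode (gramCoeffs ℓ) n)| + M * maxStep ℓ ≤
    M * maxStep ℓ *
      Real.exp (primNode (gramCoeffs ℓ) n + |q| * dualNode (gramCoeffs ℓ) n) := by
  induction n with
  | zero => simp [primNode_zero, dualNode_zero, gridCos, genCos_zero, genCosDeriv_zero]
  | succ n ih =>
    have hn' : n < ℓ := hn
    specialize ih hn'.le
    have hS := isStaggeredSolution_gridCos q ℓ
    have e1 := hS.prim_eq ⟨n, hn'⟩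
    have e2 := hS.dual_eq ⟨n, hn'⟩
    have p0 := gramCoeffs_prim_pos (⟨n, hn'⟩ : Fin ℓ)
    have d0 := gramCoeffs_dual_pos (⟨n, hn'⟩ : Fin ℓ)
    have p1 := gramCoeffs_prim_le (⟨n, hn'⟩ : Fin ℓ)
    have d1 := gramCoeffs_dual_le (⟨n, hn'⟩ : Fin ℓ)
    have zp := primNode_succ (gramCoeffs ℓ) hn'
    have zd := dualNode_succ (gramCoeffs ℓ) hn'
    obtain ⟨⟨i1, -⟩, i2, -⟩ := interlacing hn'
    have i0 := dualNode_le_primNode hn'.le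
    have hz1 := primNode_le_one hn
    have hz0 := primNode_nonneg (ℓ := ℓ) n
    have hd0 := dualNode_nonneg (ℓ := ℓ) n
    simp only at e1 e2
    set α := (gramCoeffs ℓ).prim ⟨n, hn'⟩
    set β := (gramCoeffs ℓ).dual ⟨n, hn'⟩
    set z := primNode (gramCoeffs ℓ) n
    set z' := primNode (gramCoeffs ℓ) (n + 1)
    set d := dualNode (gramCoeffs ℓ) n
    set d' := dualNode (gramCoeffs ℓ) (n + 1)
    set S := (gridCos q (2 * ℓ) n).1
    set S' := (gridCos q (2 * ℓ) (n + 1)).1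
    set V := (gridCos q (2 * ℓ) n).2
    set V' := (gridCos q (2 * ℓ) (n + 1)).2
    set η := maxStep ℓ
    have hη : 0 < η := p0.trans_le p1
    have hq0 := abs_nonneg q
    have c1 := abs_sub_sub_mul_le (a := z) (b := z') (c := d') (M := M) hz0 hz1
      (hasDerivAt_genCos q) (hasDerivAt_genCosDeriv q) (fun x hx => (hM x hx).2.2) ⟨i1, i2⟩
    have c2 := abs_sub_sub_mul_le (a := d) (b := d') (c := z) (M := |q| * M) hd0 (i2.trans hz1)
      (hasDerivAt_genCosDeriv q) (fun x => (hasDerivAt_genCos q x).const_mul q)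
      (fun x hx => by
        rw [abs_mul]
        exact mul_le_mul_of_nonneg_left (hM x hx).2.1 hq0) ⟨i0, i1⟩
    rw [show z' - z = α by linarith] at c1
    rw [show d' - d = β by linarith] at c2
    have b1 : |V' - genCosDeriv q d'| ≤
        |V - genCosDeriv q d| + |q| * β * |S - genCos q z| + |q| * β * (M * η) := by
      have heq : V' - genCosDeriv q d' = (V - genCosDeriv q d) + q * β * (S - genCos q z)
          - (genCosDeriv q d' - genCosDeriv q d - β * (q * genCos q z)) := by
        linear_combination e2
      rw [heq]
      refine (abs_sub _ _).trans ?_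
      refine add_le_add ((abs_add_le _ _).trans ?_) (c2.trans ?_)
      · rw [abs_mul, abs_mul, abs_of_pos d0]
      · have := mul_le_mul_of_nonneg_left d1 (mul_nonneg (mul_nonneg hq0 hM0.le) d0.le)
        linarith
    have b2 : |S' - genCos q z'| ≤
        |S - genCos q z| + α * |V' - genCosDeriv q d'| + α * (M * η) := by
      have heq : S' - genCos q z' = (S - genCos q z) + α * (V' - genCosDeriv q d')
          - (genCos q z' - genCos q z - α * genCosDeriv q d') := by
        linear_combination -e1
      rw [heq]
      refine (abs_sub _ _).trans ?_
      refine add_le_add ((abs_add_le _ _).trans ?_) (c1.trans ?_)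
      · rw [abs_mul, abs_of_pos p0]
      · have := mul_le_mul_of_nonneg_left p1 (mul_nonneg hM0.le p0.le)
        linarith
    set E := |S - genCos q z|
    set F := |V - genCosDeriv q d|
    set E' := |S' - genCos q z'|
    set F' := |V' - genCosDeriv q d'|
    have hE : 0 ≤ E := abs_nonneg _
    have hF : 0 ≤ F := abs_nonneg _
    have hβ : 0 ≤ |q| * β := mul_nonneg hq0 d0.le
    have hMη : 0 < M * η := mul_pos hM0 hη
    have s1 : E + F' + M * η ≤ (1 + |q| * β) * (E + F + M * η) := by
      nlinarith [mul_nonneg hβ hF]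
    have s2 : E' + F' + M * η ≤ (1 + α) * (E + F' + M * η) := by
      nlinarith [mul_nonneg p0.le hE]
    calc E' + F' + M * η ≤ (1 + α) * ((1 + |q| * β) * (E + F + M * η)) :=
          s2.trans (mul_le_mul_of_nonneg_left s1 (by linarith))
      _ ≤ Real.exp α * (Real.exp (|q| * β) * (M * η * Real.exp (z + |q| * d))) := by
          have x1 : 1 + α ≤ Real.exp α := by linarith [Real.add_one_le_exp α]
          have x2 : 1 + |q| * β ≤ Real.exp (|q| * β) := by linarith [Real.add_one_le_exp (|q| * β)]
          gcongr
      _ = M * η * Real.exp (z' + |q| * d') := by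
          rw [zp, zd, show z + α + |q| * (d + β) = α + (|q| * β + (z + |q| * d)) by ring,
            Real.exp_add α, Real.exp_add (|q| * β)]
          ring

/-! ### Uniform convergence of the reconstruction. -/

/-- The distance within which the primary nodes next to a point of `[0,1]` lie. -/
def gridGap (ℓ : ℕ) : ℝ := maxStep ℓ + (1 - primNode (gramCoeffs ℓ) ℓ)

lemma tendsto_gridGap : Tendsto gridGap atTop (𝓝 0) := by
  have h := tendsto_optimalStep_last.add (tendsto_primNode_last.const_sub 1)
  rw [sub_self, add_zero] at h
  exact h

lemma maxStep_le_gridGap (ℓ : ℕ) : maxStep ℓ ≤ gridGap ℓ := by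
  have := primNode_le_one (le_refl ℓ)
  unfold gridGap
  linarith

/-- Products of two neighbouring values of the discrete solution approximate `sigmaConst q`. -/
lemma exists_product_error (q : ℝ) : ∃ ε : ℕ → ℝ, Tendsto ε atTop (𝓝 0) ∧ ∀ ℓ, 0 < ℓ → 0 ≤ ε ℓ ∧
    ∀ m ≤ ℓ, ∀ n ≤ ℓ, ∀ x ∈ Icc (0 : ℝ) 1, |primNode (gramCoeffs ℓ) m - x| ≤ gridGap ℓ →
      |primNode (gramCoeffs ℓ) n - x| ≤ gridGap ℓ →
      |(gridCos q (2 * ℓ) m).1 * (gridCos q (2 * ℓ) n).1 - sigmaConst q x| ≤ ε ℓ := by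
  obtain ⟨M, hM0, hM⟩ := exists_bound_genCos q
  set C := M * Real.exp (1 + |q|) + M with hC
  have hC0 : 0 < C := by positivity
  refine ⟨fun ℓ => C * gridGap ℓ * (2 * M + C * gridGap ℓ), ?_, fun ℓ hℓ => ?_⟩
  · have h := tendsto_gridGap.const_mul C
    have h2 := h.mul (h.const_add (2 * M))
    simpa using h2
  have hgap : 0 ≤ gridGap ℓ := (maxStep_nonneg hℓ).trans (maxStep_le_gridGap ℓ)
  have hnode : ∀ n ≤ ℓ, ∀ x ∈ Icc (0 : ℝ) 1, |primNode (gramCoeffs ℓ) n - x| ≤ gridGap ℓ →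
      |(gridCos q (2 * ℓ) n).1 - genCos q x| ≤ C * gridGap ℓ := by
    intro n hn x hx hnx
    have h1 := gridCos_error hM0 hM hn
    have h2 : |(gridCos q (2 * ℓ) n).1 - genCos q (primNode (gramCoeffs ℓ) n)| ≤
        M * Real.exp (1 + |q|) * gridGap ℓ := by
      have hη := maxStep_nonneg hℓ
      have hz1 := primNode_le_one hn
      have hd1 := (dualNode_le_primNode hn).trans hz1
      have hV := abs_nonneg
        ((gridCos q (2 * ℓ) n).2 - genCosDeriv q (dualNode (gramCoeffs ℓ) n))
      have hMη := mul_nonneg hM0.le hη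
      calc _ ≤ M * maxStep ℓ *
            Real.exp (primNode (gramCoeffs ℓ) n + |q| * dualNode (gramCoeffs ℓ) n) := by linarith
        _ ≤ M * gridGap ℓ * Real.exp (1 + |q|) := by
          have := maxStep_le_gridGap ℓ
          have h3 : |q| * dualNode (gramCoeffs ℓ) n ≤ |q| :=
            mul_le_of_le_one_right (abs_nonneg q) hd1
          gcongr
        _ = _ := by ring
    have h3 := abs_sub_le_of_hasDerivAt (fun x _ => hasDerivAt_genCos q x)
      (fun x hx => (hM x hx).2.1) ⟨primNode_nonneg n, primNode_le_one hn⟩ hx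
    have h4 := mul_le_mul_of_nonneg_left hnx hM0.le
    calc _ ≤ _ := abs_sub_le _ (genCos q (primNode (gramCoeffs ℓ) n)) _
      _ ≤ M * Real.exp (1 + |q|) * gridGap ℓ + M * gridGap ℓ := add_le_add h2 (h3.trans h4)
      _ = C * gridGap ℓ := by rw [hC]; ring
  refine ⟨by positivity, fun m hm n hn x hx hmx hnx => ?_⟩
  have h1 := hnode m hm x hx hmx
  have h2 := hnode n hn x hx hnx
  have h3 := (hM x hx).1
  rw [sigmaConst_eq_sq]
  set a := (gridCos q (2 * ℓ) m).1
  set b := (gridCos q (2 * ℓ) n).1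
  set c := genCos q x
  have he : 0 ≤ C * gridGap ℓ := by positivity
  calc |a * b - c ^ 2| = |(a - c) * (b - c) + c * (a - c) + c * (b - c)| := by congr 1; ring
    _ ≤ |(a - c) * (b - c)| + |c * (a - c)| + |c * (b - c)| := abs_add_three _ _ _
    _ ≤ C * gridGap ℓ * (C * gridGap ℓ) + M * (C * gridGap ℓ) + M * (C * gridGap ℓ) := by
        rw [abs_mul, abs_mul, abs_mul]
        gcongr
    _ = _ := by ring

lemma primValue_liouvilleCoeffs (q : ℝ) {ℓ : ℕ} (j : Fin ℓ) :
    primValue (gramCoeffs ℓ) (liouvilleCoeffs q ℓ) j =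
      (gridCos q (2 * ℓ) j).1 * (gridCos q (2 * ℓ) j).1 := by
  have := (gramCoeffs_dual_pos j).ne'
  simp only [primValue, liouvilleCoeffs]
  field_simp

lemma dualValue_liouvilleCoeffs (q : ℝ) {ℓ : ℕ} (j : Fin ℓ) :
    dualValue (gramCoeffs ℓ) (liouvilleCoeffs q ℓ) j =
      (gridCos q (2 * ℓ) j).1 * (gridCos q (2 * ℓ) (j + 1)).1 := by
  have := (gramCoeffs_prim_pos j).ne'
  simp only [dualValue, liouvilleCoeffs]
  rw [div_div_cancel₀ this]

lemma exists_node_interval {ℓ : ℕ} {x : ℝ} (hx0 : 0 ≤ x) (hx : x < primNode (gramCoeffs ℓ) ℓ) :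
    ∃ j : Fin ℓ, primNode (gramCoeffs ℓ) j ≤ x ∧ x < primNode (gramCoeffs ℓ) (j + 1) := by
  classical
  have hex : ∃ k, x < primNode (gramCoeffs ℓ) k := ⟨ℓ, hx⟩
  have h1 := Nat.find_spec hex
  have h2 : Nat.find hex ≠ 0 := by
    intro h
    rw [h, primNode_zero] at h1
    linarith
  have h3 : Nat.find hex ≤ ℓ := Nat.find_min' hex hx
  refine ⟨⟨Nat.find hex - 1, by omega⟩, ?_, ?_⟩
  · exact not_lt.1 (Nat.find_min hex (by omega : Nat.find hex - 1 < Nat.find hex))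
  · rw [show Nat.find hex - 1 + 1 = Nat.find hex by omega]
    exact h1

lemma reconstruction_eq_of_last_le (q : ℝ) {ℓ : ℕ} (hℓ : 0 < ℓ) {x : ℝ} (hx1 : x ≤ 1)
    (hx : primNode (gramCoeffs ℓ) ℓ ≤ x) :
    reconstruction (gramCoeffs ℓ) (liouvilleCoeffs q ℓ) x =
      (gridCos q (2 * ℓ) (ℓ - 1)).1 * (gridCos q (2 * ℓ) ℓ).1 := by
  have hmono := primNode_mono (gramCoeffs_prim_pos (ℓ := ℓ))
  unfold reconstruction
  rw [Finset.sum_eq_single ⟨ℓ - 1, by omega⟩]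
  · have h1 : ℓ - 1 + 1 = ℓ := by omega
    have h2 := (interlacing (show ℓ - 1 < ℓ by omega)).2.1
    simp only [h1] at h2 ⊢
    rw [indicator_of_notMem (fun h => absurd h.2 (not_lt.2 (h2.trans hx))),
      indicator_of_notMem (fun h => absurd h.2 (not_lt.2 hx)), if_pos trivial,
      indicator_of_mem (show x ∈ Icc _ _ from ⟨hx, hx1⟩), dualValue_liouvilleCoeffs]
    simp [h1]
  · intro k _ hk
    have h1 : primNode (gramCoeffs ℓ) (k + 1) ≤ x := (hmono (show k.val + 1 ≤ ℓ from k.2)).trans hx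
    have h2 := (interlacing k.2).2.1
    have h3 : k.val + 1 ≠ ℓ := fun h => hk (Fin.ext (by simp only; omega))
    rw [indicator_of_notMem (fun h => absurd h.2 (not_lt.2 (h2.trans h1))),
      indicator_of_notMem (fun h => absurd h.2 (not_lt.2 h1)), if_neg h3]
    simp
  · simp

lemma reconstruction_eq_of_mem (q : ℝ) {ℓ : ℕ} {x : ℝ} (j : Fin ℓ)
    (hj : primNode (gramCoeffs ℓ) j ≤ x) (hj' : x < primNode (gramCoeffs ℓ) (j + 1)) :
    reconstruction (gramCoeffs ℓ) (liouvilleCoeffs q ℓ) x =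
      if x < dualNode (gramCoeffs ℓ) (j + 1) then primValue (gramCoeffs ℓ) (liouvilleCoeffs q ℓ) j
      else dualValue (gramCoeffs ℓ) (liouvilleCoeffs q ℓ) j := by
  have hmono := primNode_mono (gramCoeffs_prim_pos (ℓ := ℓ))
  have hlast : x < primNode (gramCoeffs ℓ) ℓ := hj'.trans_le (hmono (show j.val + 1 ≤ ℓ from j.2))
  have h3 : (Icc (primNode (gramCoeffs ℓ) ℓ) 1).indicator
      (fun _ => dualValue (gramCoeffs ℓ) (liouvilleCoeffs q ℓ) j) x = 0 :=
    indicator_of_notMem (fun h => absurd h.1 (not_le.2 hlast)) _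
  unfold reconstruction
  rw [Finset.sum_eq_single j]
  · rw [h3, ite_self, add_zero]
    split_ifs with h
    · rw [indicator_of_mem (show x ∈ Ico _ _ from ⟨hj, h⟩),
        indicator_of_notMem (fun h' => absurd h'.1 (not_le.2 h)), add_zero]
    · rw [indicator_of_notMem (fun h' => absurd h'.2 h),
        indicator_of_mem (show x ∈ Ico _ _ from ⟨not_lt.1 h, hj'⟩), zero_add]
  · intro k _ hk
    have hi := interlacing k.2
    have hk3 : (Icc (primNode (gramCoeffs ℓ) ℓ) 1).indicator
        (fun _ => dualValue (gramCoeffs ℓ) (liouvilleCoeffs q ℓ) k) x = 0 :=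
      indicator_of_notMem (fun h => absurd h.1 (not_le.2 hlast)) _
    rw [hk3, ite_self, add_zero]
    rcases lt_or_gt_of_ne (fun h => hk (Fin.ext h) : k.val ≠ j.val) with h | h
    · have h1 : primNode (gramCoeffs ℓ) (k + 1) ≤ x := (hmono h).trans hj
      rw [indicator_of_notMem (fun h => absurd h.2 (not_lt.2 (hi.2.1.trans h1))),
        indicator_of_notMem (fun h => absurd h.2 (not_lt.2 h1)), add_zero]
    · have h1 : x < primNode (gramCoeffs ℓ) k := hj'.trans_le (hmono h)
      rw [indicator_of_notMem (fun h => absurd h.1 (not_le.2 h1)),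
        indicator_of_notMem (fun h => absurd h.1 (not_le.2 (h1.trans_le hi.1.1))), add_zero]
  · simp

lemma abs_primNode_sub_le {ℓ : ℕ} (j : Fin ℓ) {x : ℝ} (hj : primNode (gramCoeffs ℓ) j ≤ x)
    (hj' : x ≤ primNode (gramCoeffs ℓ) (j + 1)) :
    |primNode (gramCoeffs ℓ) j - x| ≤ gridGap ℓ ∧
      |primNode (gramCoeffs ℓ) (j + 1) - x| ≤ gridGap ℓ := by
  have h1 := primNode_succ (gramCoeffs ℓ) j.2
  have h2 := gramCoeffs_prim_le j
  have h3 := maxStep_le_gridGap ℓ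
  simp only [Fin.eta] at h1
  constructor <;> rw [abs_le] <;> constructor <;> linarith

/-- Uniform convergence of the nodal values and of the reconstruction for the explicit
coefficients. -/
lemma exists_uniform_error (q : ℝ) : ∃ ε : ℕ → ℝ, Tendsto ε atTop (𝓝 0) ∧ ∀ ℓ, 0 < ℓ → 0 ≤ ε ℓ ∧
    (∀ j : Fin ℓ, |primValue (gramCoeffs ℓ) (liouvilleCoeffs q ℓ) j
      - sigmaConst q (primNode (gramCoeffs ℓ) j)| ≤ ε ℓ) ∧
    (∀ j : Fin ℓ, |dualValue (gramCoeffs ℓ) (liouvilleCoeffs q ℓ) j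
      - sigmaConst q (dualNode (gramCoeffs ℓ) (j + 1))| ≤ ε ℓ) ∧
    ∀ x ∈ Icc (0 : ℝ) 1,
      |reconstruction (gramCoeffs ℓ) (liouvilleCoeffs q ℓ) x - sigmaConst q x| ≤ ε ℓ := by
  obtain ⟨ε, hε, h⟩ := exists_product_error q
  refine ⟨ε, hε, fun ℓ hℓ => ?_⟩
  obtain ⟨hε0, h⟩ := h ℓ hℓ
  have hprim : ∀ (j : Fin ℓ) (x : ℝ), primNode (gramCoeffs ℓ) j ≤ x →
      x ≤ primNode (gramCoeffs ℓ) (j + 1) →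
      |primValue (gramCoeffs ℓ) (liouvilleCoeffs q ℓ) j - sigmaConst q x| ≤ ε ℓ := by
    intro j x h1 h2
    have hx := abs_primNode_sub_le j h1 h2
    rw [primValue_liouvilleCoeffs]
    exact h j j.2.le j j.2.le x
      ⟨(primNode_nonneg _).trans h1, h2.trans (primNode_le_one j.2)⟩ hx.1 hx.1
  have hdual : ∀ (j : Fin ℓ) (x : ℝ), primNode (gramCoeffs ℓ) j ≤ x →
      x ≤ primNode (gramCoeffs ℓ) (j + 1) →
      |dualValue (gramCoeffs ℓ) (liouvilleCoeffs q ℓ) j - sigmaConst q x| ≤ ε ℓ := by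
    intro j x h1 h2
    have hx := abs_primNode_sub_le j h1 h2
    rw [dualValue_liouvilleCoeffs]
    exact h j j.2.le (j + 1) j.2 x
      ⟨(primNode_nonneg _).trans h1, h2.trans (primNode_le_one j.2)⟩ hx.1 hx.2
  refine ⟨hε0, fun j => hprim j _ le_rfl (primNode_mono gramCoeffs_prim_pos (Nat.le_succ _)),
    fun j => hdual j _ (interlacing j.2).1.1 (interlacing j.2).2.1, fun x hx => ?_⟩
  rcases lt_or_ge x (primNode (gramCoeffs ℓ) ℓ) with hlt | hge
  · obtain ⟨j, h1, h2⟩ := exists_node_interval hx.1 hlt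
    rw [reconstruction_eq_of_mem q j h1 h2]
    split_ifs
    · exact hprim j x h1 h2.le
    · exact hdual j x h1 h2.le
  · rw [reconstruction_eq_of_last_le q hℓ hx.2 hge]
    have h1 := primNode_succ (gramCoeffs ℓ) (show ℓ - 1 < ℓ by omega)
    have h2 := gramCoeffs_prim_le (⟨ℓ - 1, by omega⟩ : Fin ℓ)
    have h3 := gramCoeffs_prim_pos (⟨ℓ - 1, by omega⟩ : Fin ℓ)
    have h4 := maxStep_nonneg hℓ
    rw [show ℓ - 1 + 1 = ℓ by omega] at h1
    have hx2 := hx.2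
    -- Beyond the last node, `x` may also be `1 - primNode (gramCoeffs ℓ) ℓ` away from it; the
    -- second term of `gridGap` accounts for this.
    refine h (ℓ - 1) (by omega) ℓ le_rfl x hx ?_ ?_ <;>
    · unfold gridGap
      rw [abs_le]
      constructor <;> linarith

lemma tendsto_iSup_of_le {f : (ℓ : ℕ) → Fin ℓ → ℝ} {ε : ℕ → ℝ} (hε : Tendsto ε atTop (𝓝 0))
    (hf0 : ∀ ℓ j, 0 ≤ f ℓ j) (hf : ∀ ℓ, 0 < ℓ → 0 ≤ ε ℓ ∧ ∀ j, f ℓ j ≤ ε ℓ) :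
    Tendsto (fun ℓ => ⨆ j, f ℓ j) atTop (𝓝 0) := by
  refine tendsto_of_tendsto_of_tendsto_of_le_of_le' tendsto_const_nhds hε
    (Eventually.of_forall fun ℓ => Real.iSup_nonneg (hf0 ℓ)) ?_
  filter_upwards [eventually_gt_atTop 0] with ℓ hℓ
  exact Real.iSup_le (hf ℓ hℓ).2 (hf ℓ hℓ).1

lemma existsUnique_isSpectralData {q : ℝ} (hq : -(Real.pi ^ 2 / 4) < q) :
    ∃! D : SpectralData, IsSpectralData (sigmaConst q) D :=
  ⟨specData q, isSpectralData_specData hq, fun _ hD => hD.eq_specData hq⟩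

end

theorem theorem2 (q : ℝ) (hq : -(Real.pi ^ 2 / 4) < q) :
    -- the spectral data of both conductivities, and the solutions of the discrete inverse
    -- spectral problems with these data, exist and are unique
    (∃! D : SpectralData, IsSpectralData sigmaRef D) ∧
    (∃! D : SpectralData, IsSpectralData (sigmaConst q) D) ∧
    ∀ D₀ Dq : SpectralData, IsSpectralData sigmaRef D₀ → IsSpectralData (sigmaConst q) Dq →
      (∀ ℓ : ℕ, ∃! c : Coeffs ℓ, SolvesInverse D₀ c) ∧
      (∀ ℓ : ℕ, ∃! c : Coeffs ℓ, SolvesInverse Dq c) ∧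
      ∀ c₀ cq : (ℓ : ℕ) → Coeffs ℓ,
        (∀ ℓ, SolvesInverse D₀ (c₀ ℓ)) → (∀ ℓ, SolvesInverse Dq (cq ℓ)) →
        -- uniform convergence at the primary and at the dual nodes
        Tendsto (fun ℓ : ℕ => ⨆ j : Fin ℓ,
          |primValue (c₀ ℓ) (cq ℓ) j - sigmaConst q (primNode (c₀ ℓ) j.val)|) atTop (𝓝 0) ∧
        Tendsto (fun ℓ : ℕ => ⨆ j : Fin ℓ,
          |dualValue (c₀ ℓ) (cq ℓ) j - sigmaConst q (dualNode (c₀ ℓ) (j.val + 1))|)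
          atTop (𝓝 0) ∧
        -- convergence of the reconstruction in the norm of `L^∞[0,1]`
        Tendsto (fun ℓ : ℕ =>
          eLpNorm (fun ζ => reconstruction (c₀ ℓ) (cq ℓ) ζ - sigmaConst q ζ) ⊤
            (volume.restrict (Icc (0 : ℝ) 1))) atTop (𝓝 0) := by
  have h0 := neg_pi_sq_div_four_neg
  rw [sigmaRef_eq]
  refine ⟨existsUnique_isSpectralData h0, existsUnique_isSpectralData hq,
    fun D₀ Dq hD₀ hDq => ?_⟩
  have hinj₀ := hD₀.injective_eigenvalue
  have hinjq := hDq.injective_eigenvalue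
  -- Uniqueness replaces the arbitrary spectral data, and below the arbitrary coefficients, by the
  -- explicit ones.
  obtain rfl := hD₀.eq_specData h0
  obtain rfl := hDq.eq_specData hq
  refine ⟨fun ℓ => ⟨gramCoeffs ℓ, solvesInverse_gramCoeffs ℓ, fun c hc =>
      hc.unique (solvesInverse_gramCoeffs ℓ) hinj₀⟩,
    fun ℓ => ⟨liouvilleCoeffs q ℓ, solvesInverse_liouvilleCoeffs hq ℓ, fun c hc =>
      hc.unique (solvesInverse_liouvilleCoeffs hq ℓ) hinjq⟩, fun c₀ cq hc₀ hcq => ?_⟩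
  obtain rfl : c₀ = gramCoeffs := funext fun ℓ =>
    (hc₀ ℓ).unique (solvesInverse_gramCoeffs ℓ) hinj₀
  obtain rfl : cq = liouvilleCoeffs q := funext fun ℓ =>
    (hcq ℓ).unique (solvesInverse_liouvilleCoeffs hq ℓ) hinjq
  obtain ⟨ε, hε, h⟩ := exists_uniform_error q
  refine ⟨tendsto_iSup_of_le hε (fun _ _ => abs_nonneg _) fun ℓ hℓ => ⟨(h ℓ hℓ).1, (h ℓ hℓ).2.1⟩,
    tendsto_iSup_of_le hε (fun _ _ => abs_nonneg _) fun ℓ hℓ => ⟨(h ℓ hℓ).1, (h ℓ hℓ).2.2.1⟩, ?_⟩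
  have hof : Tendsto (fun ℓ => ENNReal.ofReal (ε ℓ)) atTop (𝓝 0) := by
    simpa using ENNReal.tendsto_ofReal hε
  refine tendsto_of_tendsto_of_tendsto_of_le_of_le' tendsto_const_nhds hof
    (Eventually.of_forall fun _ => zero_le) ?_
  filter_upwards [eventually_gt_atTop 0] with ℓ hℓ
  rw [eLpNorm_exponent_top]
  refine eLpNormEssSup_le_of_ae_bound ?_
  filter_upwards [ae_restrict_mem measurableSet_Icc] with x hx
  exact (h ℓ hℓ).2.2.2 x hx
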